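/- **Setting.** Fix $m$ and commodities $1,\dots,m$. A *mechanism* consists of a finite set $K=K_1\amalg\dots\amalg K_m$ of indices ($h\in K_i$ is an *$i$-index*), the offer space $S=\mathbb R_+^K$ with $S_+=\mathbb R_{++}^K$, and for each $n\ge 1$ a return map $\rho^n:\{(a^1,\dots,a^n)\in S^n:\sum_s a^s\in S_+\}\to(\mathbb R_+^m)^n$. For $a\in S$ let $\bar a\in\mathbb R_+^m$, $\bar a_i=\sum_{h\in K_i}a_h$. For $\lambda\in\mathbb R_{++}^m$ let $(\lambda * r)_i=\lambda_i r_i$ for $r\in\mathbb R_+^m$, and $(\lambda * a)_h=\lambda_i a_h$ for $a\in S$, $h\in K_i$. Let $\rho=\rho(a,c)$ be the first component of $\rho^2(a,c)$, and $e_h$ the unit offer of the index $h$. An $h\in K_i$ is an *$ij$-index* if $\rho_j(e_h,a)>0$ for some $a$; an $ij$-index $h$ is *pure* if $\rho_k(e_h,a)=0$ for all $a$ and all $k\ne j$. Let $\mathfrak M$ be the class of all mechanisms such that, whenever $\rho^n(a^1,\dots,a^n)=(r^1,\dots,r^n)$: $\sum_s r^s=\sum_s\overline{a^s}$ (conservation);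 $\rho^n(a^{\sigma(1)},\dots,a^{\sigma(n)})=(r^{\sigma(1)},\dots,r^{\sigma(n)})$ for each permutation $\sigma$ (Anonymity); for $n\ge 2$, $\rho^{n-1}(a^1,\dots,a^{n-2},a^{n-1}+a^n)=(r^1,\dots,r^{n-2},r^{n-1}+r^n)$ (Aggregation); $\rho^n(\lambda * a^1,\dots,\lambda * a^n)=(\lambda * r^1,\dots,\lambda * r^n)$ for all $\lambda\in\mathbb R_{++}^m$ (Invariance); each $r^s-\overline{a^s}$ is $0$ or has a strictly positive component (Non-dissipation); for all $i,j$, if there is an $ij$-index then there is a pure $ij$-index (Flexibility); and such that the mechanism is connected in the sense defined below. **Complexities.** The net trade $\nu(a,b)=\rho(a,b-a)-\bar a$ ($a\in S$, $b\in S_+$, $a\le b$) is extended to $S\times S_+$ by $\nu(a,tb)=\nu(a,b)$ for $t>0$. Write $v\to w$, for $v,w\in\mathbb R_+^m$, if $w=v+\nu(a,b)$ for some $a\in S$, $b\in S_+$ with $\bar a\le v$. The time complexity $\tau_{ij}\in\mathbb N\cup\{\infty\}$ is the least $t\ge1$ for which there is a sequence $e_i=v^0\to v^1\to\dots\to v^t=e_j$,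 and the mechanism is connected if $\max_{i\ne j}\tau_{ij}<\infty$. For a mechanism in $\mathfrak M$ and $b\in S_+$ there is a strictly positive price vector $p(b)$, unique up to scaling, with $p(b)\cdot\nu(a,b)=0$ for all $a\in S$; the price complexity $\pi_{ij}$ is the number of components of $b$ on which the function $p_{ij}(b)=p_i(b)/p_j(b)$ depends (that is, for which two inputs differing only in this component give different values). The index count is $k_i=|K_i|$. Write $M\preceq M'$ if $\tau_{ij}\le\tau'_{ij}$, $\pi_{ij}\le\pi'_{ij}$ and $k_i\le k'_i$ for all $i,j$. A mechanism $M\in\mathfrak M$ is *minimal* if, for all $M'\in\mathfrak M$, $M'\preceq M$ implies $M\preceq M'$. Mechanisms that differ only by bijections of the sets $K_i$ are identified, and $\mathfrak M_*$ is the set of minimal mechanisms. **$G$-mechanisms.** Let $G$ be a connected directed graph without loops on $\{1,\dots,m\}$, where connected means that for all $i\neq j$ there is a directed path from $i$ to $j$. The $G$-mechanism $M_G$ has as $K_i$ the set of edges $ij$ out of $i$ (put $a_{ij}=0$ if $ij$ is not an edge). For $b\in S_+$ let $p=p(b)\in\mathbb R_{++}^m$ be the vector, unique up to scaling, with $\sum_i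 p_i b_{ij}=\sum_i p_j b_{ji}$ for all $j$, and put $r_i(a,b)=p_i^{-1}\sum_j p_j a_{ji}$; trader $s$ receives $r(a^s,b)$, where $b=a^1+\dots+a^n$. Let $\mathfrak M_g$ be the set of these mechanisms. **Theorem.** Every minimal mechanism $M$ is a $G$-mechanism: for some connected directed graph $G$ without loops, there are bijections between the sets $K_i$ of $M$ and the sets of edges of $G$ out of $i$ that carry the return maps of $M$ to those of $M_G$, and the index of $M$ that corresponds to the edge $ij$ is a pure $ij$-index of $M$. Hence $\mathfrak M_*\subset\mathfrak M_g$, and $\mathfrak M_*$ is finite. -/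

import Mathlib

open scoped NNReal

noncomputable section

namespace ExchangeMechanism

/-- A pre-mechanism on the commodities `Fin m`. The commodity space is `Fin m → ℝ≥0`, the finite
set of `i`-indices is `K i`, an offer is a family `a i h` of nonnegative reals (`h : K i`), and the
return map `ρ n` is defined on `n`-tuples of offers whose sum is strictly positive in every
component. (For `n = 0` the codomain of `ρ 0` has one point, so `ρ 0` carries no information.) -/
structure PreMechanism (m : ℕ) where
  K : Fin m → Type
  fintypeK : ∀ i, Fintype (K i)
  ρ : ∀ (n : ℕ) (a : Fin n → (i : Fin m) → K i → ℝ≥0),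
    (∀ i h, 0 < ∑ s, a s i h) → Fin n → Fin m → ℝ≥0

instance {m : ℕ} (M : PreMechanism m) (i : Fin m) : Fintype (M.K i) := M.fintypeK i

/-- The sum of the last two entries of a tuple takes the place of its last two entries:
`(x¹, …, xⁿ, xⁿ⁺¹, xⁿ⁺²) ↦ (x¹, …, xⁿ, xⁿ⁺¹ + xⁿ⁺²)`. -/
def mergeLast {X : Type} [Add X] {n : ℕ} (x : Fin (n + 2) → X) : Fin (n + 1) → X :=
  Fin.snoc (fun s : Fin n => x s.castSucc.castSucc)
    (x (Fin.last n).castSucc + x (Fin.last (n + 1)))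

namespace PreMechanism

variable {m : ℕ} (M : PreMechanism m)

/-- The action space `S`. -/
abbrev Offer : Type := (i : Fin m) → M.K i → ℝ≥0

/-- The strictly positive offers `S₊`. -/
abbrev State : Type := {b : M.Offer // ∀ i h, 0 < b i h}

/-- Membership of an `n`-tuple of offers in the domain `S(n)` of `ρ n`. -/
abbrev PosAgg {n : ℕ} (a : Fin n → M.Offer) : Prop := ∀ i h, 0 < ∑ s, a s i h

/-- The total offer `ā` of each commodity. -/
def total (a : M.Offer) : Fin m → ℝ≥0 := fun i => ∑ h, a i h

/-- The scaling action `lam ∗ a` of a change of units on offers. -/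
def rescale (lam : Fin m → ℝ≥0) (a : M.Offer) : M.Offer := fun i h => lam i * a i h

open Classical in
/-- The unit offer `e_h` for an `i`-index `h`. -/
def unitOffer {i : Fin m} (h : M.K i) : M.Offer := Pi.single i (Pi.single h 1)

/-- `h ∈ K i` is an `ij`-index: `ρ_j(e_h, a) > 0` for some `a`. -/
def IsIndex {i : Fin m} (j : Fin m) (h : M.K i) : Prop :=
  ∃ (a : M.Offer) (ha : M.PosAgg ![M.unitOffer h, a]), 0 < M.ρ 2 ![M.unitOffer h, a] ha 0 j

/-- `h ∈ K i` is a pure `ij`-index. -/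
def IsPureIndex {i : Fin m} (j : Fin m) (h : M.K i) : Prop :=
  M.IsIndex j h ∧
    ∀ (a : M.Offer) (ha : M.PosAgg ![M.unitOffer h, a]), ∀ k, k ≠ j →
      M.ρ 2 ![M.unitOffer h, a] ha 0 k = 0

/-- Conservation of commodities, which makes a pre-mechanism an exchange mechanism. -/
def IsExchange : Prop :=
  ∀ (n : ℕ) (a : Fin n → M.Offer) (ha : M.PosAgg a),
    ∑ s, M.ρ n a ha s = ∑ s, M.total (a s)

def Anonymity : Prop :=
  ∀ (n : ℕ) (a : Fin n → M.Offer) (ha : M.PosAgg a) (σ : Equiv.Perm (Fin n))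
    (ha' : M.PosAgg (fun s => a (σ s))),
    M.ρ n (fun s => a (σ s)) ha' = fun s => M.ρ n a ha (σ s)

def Aggregation : Prop :=
  ∀ (n : ℕ) (a : Fin (n + 2) → M.Offer) (ha : M.PosAgg a) (ha' : M.PosAgg (mergeLast a)),
    M.ρ (n + 1) (mergeLast a) ha' = mergeLast (M.ρ (n + 2) a ha)

def Invariance : Prop :=
  ∀ (n : ℕ) (a : Fin n → M.Offer) (ha : M.PosAgg a) (lam : Fin m → ℝ≥0), (∀ i, 0 < lam i) →
    ∀ ha' : M.PosAgg (fun s => M.rescale lam (a s)),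
      M.ρ n (fun s => M.rescale lam (a s)) ha' = fun s i => lam i * M.ρ n a ha s i

def NonDissipation : Prop :=
  ∀ (n : ℕ) (a : Fin n → M.Offer) (ha : M.PosAgg a) (s : Fin n),
    M.ρ n a ha s = M.total (a s) ∨ ∃ i, M.total (a s) i < M.ρ n a ha s i

def Flexibility : Prop :=
  ∀ i j : Fin m, (∃ h : M.K i, M.IsIndex j h) → ∃ h : M.K i, M.IsPureIndex j h

/-! ### Net trade -/

theorem posAgg_pair {a b : M.Offer} (hb : ∀ i h, 0 < b i h) (hab : a ≤ b) :
    M.PosAgg ![a, b - a] := by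
  intro i h
  have : a i h + (b i h - a i h) = b i h := add_tsub_cancel_of_le (hab i h)
  simpa [Fin.sum_univ_two, this] using hb i h

/-- The net trade `ν(a, b) = ρ(a, b - a) - ā` for `a ≤ b`. -/
def netTradeOfLE (a : M.Offer) (b : M.State) (hab : a ≤ b.1) : Fin m → ℝ :=
  fun i => (M.ρ 2 ![a, b.1 - a] (M.posAgg_pair b.2 hab) 0 i : ℝ) - M.total a i

/-- The positive multiple `t b` of a positive offer. -/
def State.smul {M : PreMechanism m} (t : ℝ≥0) (ht : 0 < t) (b : M.State) : M.State :=
  ⟨fun i h => t * b.1 i h, fun i h => mul_pos ht (b.2 i h)⟩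

/-- A positive factor `t` with `a ≤ t b`. -/
def factor (a : M.Offer) (b : M.State) : ℝ≥0 := 1 + ∑ i, ∑ h, a i h / b.1 i h

theorem factor_pos (a : M.Offer) (b : M.State) : 0 < M.factor a b :=
  lt_of_lt_of_le one_pos (le_add_of_nonneg_right (zero_le))

theorem le_factor_smul (a : M.Offer) (b : M.State) :
    a ≤ (b.smul (M.factor a b) (M.factor_pos a b)).1 := by
  intro i h
  have hb := b.2 i h
  have h1 : a i h / b.1 i h ≤ M.factor a b :=
    calc a i h / b.1 i h ≤ ∑ h, a i h / b.1 i h :=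
          Finset.single_le_sum (f := fun h => a i h / b.1 i h) (fun _ _ => zero_le)
            (Finset.mem_univ h)
      _ ≤ ∑ i, ∑ h, a i h / b.1 i h :=
          Finset.single_le_sum (f := fun i => ∑ h, a i h / b.1 i h) (fun _ _ => zero_le)
            (Finset.mem_univ i)
      _ ≤ M.factor a b := le_add_of_nonneg_left zero_le_one
  calc a i h = a i h / b.1 i h * b.1 i h := (div_mul_cancel₀ _ hb.ne').symm
    _ ≤ M.factor a b * b.1 i h := mul_le_mul_left h1 _

/-- The net trade `ν(a, b)` for arbitrary `a ∈ S` and `b ∈ S₊`: the extension of the net trade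
from `{a ≤ b}` by homogeneity of degree `0` in `b` (see `netTrade_unique`). -/
def netTrade (a : M.Offer) (b : M.State) : Fin m → ℝ :=
  M.netTradeOfLE a (b.smul (M.factor a b) (M.factor_pos a b)) (M.le_factor_smul a b)

/-- Any extension of the net trade with `ν(a, tb) = ν(a, b)` for `t > 0` is `netTrade`. -/
theorem netTrade_unique (ν : M.Offer → M.State → Fin m → ℝ)
    (hext : ∀ a b hab, ν a b = M.netTradeOfLE a b hab)
    (hhom : ∀ a b t ht, ν a (State.smul t ht b) = ν a b) : ν = M.netTrade := by
  funext a b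
  rw [← hhom a b (M.factor a b) (M.factor_pos a b)]
  exact hext _ _ _

/-! ### Complexities -/

/-- `v` can be converted to `w` in one step: `w = v + ν(a, b)` for some `a, b` with `ā ≤ v`. -/
def Converts (v w : Fin m → ℝ≥0) : Prop :=
  ∃ (a : M.Offer) (b : M.State), M.total a ≤ v ∧ ∀ i, (w i : ℝ) = v i + M.netTrade a b i

/-- `τ(v, w)`: the least `t ≥ 1` for which `v` is converted to `w` in `t` steps (`⊤` if none). -/
def conversionTime (v w : Fin m → ℝ≥0) : ℕ∞ :=
  ⨅ t ∈ {t : ℕ | 1 ≤ t ∧ ∃ x : ℕ → Fin m → ℝ≥0,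
    x 0 = v ∧ x t = w ∧ ∀ s < t, M.Converts (x s) (x (s + 1))}, (t : ℕ∞)

/-- The `ij`-time complexity `τ_ij`. -/
def timeComplexity (i j : Fin m) : ℕ∞ :=
  M.conversionTime (Pi.single i 1) (Pi.single j 1)

/-- `M` is connected: the maximum of `τ_ij` over `i ≠ j` is finite. -/
def IsConnected : Prop := (⨆ (i : Fin m) (j : Fin m) (_ : i ≠ j), M.timeComplexity i j) < ⊤

/-- `p` is a vector of strictly positive prices conserving values at `b`: `p · ν(a, b) = 0` for
all offers `a`. -/
def IsPrice (b : M.State) (p : Fin m → ℝ) : Prop :=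
  (∀ i, 0 < p i) ∧ ∀ a : M.Offer, ∑ i, p i * M.netTrade a b i = 0

/-- A representative of the ray `p(b)` of value-conserving prices. -/
def price (b : M.State) : Fin m → ℝ := Classical.epsilon (M.IsPrice b)

/-- The price ratio function `p_ij = p_i / p_j` on `S₊`. -/
def priceRatio (i j : Fin m) (b : M.State) : ℝ := M.price b i / M.price b j

/-- The component `c` is influential for `f`: two inputs differing only in the component `c` have
different values. -/
def IsInfluential (f : M.State → ℝ) (c : Σ i, M.K i) : Prop :=
  ∃ x x' : M.State, (∀ c' : Σ i, M.K i, c' ≠ c → x.1 c'.1 c'.2 = x'.1 c'.1 c'.2) ∧ f x ≠ f x'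

/-- The `ij`-price complexity `π_ij`. -/
def priceComplexity (i j : Fin m) : ℕ :=
  Nat.card {c : Σ i, M.K i // M.IsInfluential (M.priceRatio i j) c}

/-- The `i`-index complexity `k_i`. -/
def indexComplexity (i : Fin m) : ℕ := Fintype.card (M.K i)

/-- The class `𝔐(m)` of connected exchange mechanisms satisfying the five conditions. -/
structure InClass : Prop where
  exchange : M.IsExchange
  anonymity : M.Anonymity
  aggregation : M.Aggregation
  invariance : M.Invariance
  nonDissipation : M.NonDissipation
  flexibility : M.Flexibility
  connected : M.IsConnected

/-- `M` is no more complex than `M'`. -/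
def NoMoreComplex (M M' : PreMechanism m) : Prop :=
  (∀ i j, M.timeComplexity i j ≤ M'.timeComplexity i j) ∧
  (∀ i j, M.priceComplexity i j ≤ M'.priceComplexity i j) ∧
  (∀ i, M.indexComplexity i ≤ M'.indexComplexity i)

/-- `M` is a minimal element of the quasiordered class `𝔐(m)`. -/
def IsMinimal : Prop :=
  M.InClass ∧ ∀ M' : PreMechanism m, M'.InClass → M'.NoMoreComplex M → M.NoMoreComplex M'

/-! ### Relabelling of indices -/

/-- The bijections `e i` of the sets of `i`-indices carry the return maps of `M` to those of
`M'`. -/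
def IsRelabelling (M M' : PreMechanism m) (e : ∀ i, M.K i ≃ M'.K i) : Prop :=
  ∀ (n : ℕ) (a : Fin n → M'.Offer) (ha : M'.PosAgg a)
    (ha' : M.PosAgg (fun s i h => a s i (e i h))),
    M.ρ n (fun s i h => a s i (e i h)) ha' = M'.ρ n a ha

/-- Pre-mechanisms that differ only in the names of the indices are identified. -/
def relabelSetoid (m : ℕ) : Setoid (PreMechanism m) where
  r M M' := ∃ e : ∀ i, M.K i ≃ M'.K i, IsRelabelling M M' e
  iseqv :=
    { refl := fun _ => ⟨fun _ => Equiv.refl _, fun _ _ _ _ => rfl⟩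
      symm := by
        rintro M M' ⟨e, he⟩
        refine ⟨fun i => (e i).symm, fun n a ha ha' => ?_⟩
        have hq : (fun s i h => a s i ((e i).symm (e i h))) = a := by simp
        have := he n (fun s i h => a s i ((e i).symm h)) ha' (by rw [hq]; exact ha)
        rw [← this]
        congr 1
      trans := by
        rintro M M' M'' ⟨e, he⟩ ⟨f, hf⟩
        refine ⟨fun i => (e i).trans (f i), fun n a ha ha' => ?_⟩
        have hp : M'.PosAgg (fun s i h => a s i (f i h)) := fun i h => ha i (f i h)
        rw [← hf n a ha hp]
        exact he n (fun s i h => a s i (f i h)) hp ha' }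

end PreMechanism

/-! ### Graphical mechanisms -/

/-- A directed simple graph on the commodities that is connected: any two distinct vertices
`i, j` are joined by a path from `i` to `j`. -/
def IsConnectedGraph {m : ℕ} (G : Digraph (Fin m)) : Prop :=
  (∀ i, ¬ G.Adj i i) ∧ ∀ i j, i ≠ j → Relation.TransGen G.Adj i j

open Classical in
/-- An offer of the `G`-mechanism as an `m × m` matrix, with entry `0` outside the edges. -/
def edgeMatrix {m : ℕ} (G : Digraph (Fin m)) (a : (i : Fin m) → {j // G.Adj i j} → ℝ≥0)
    (i j : Fin m) : ℝ≥0 :=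
  if h : G.Adj i j then a i ⟨j, h⟩ else 0

/-- The market-clearing prices of `G` at `b`: `p > 0` and `∑ᵢ pᵢ bᵢⱼ = ∑ᵢ pⱼ bⱼᵢ` for all `j`. -/
def IsGraphPrice {m : ℕ} (G : Digraph (Fin m)) (b : (i : Fin m) → {j // G.Adj i j} → ℝ≥0)
    (p : Fin m → ℝ≥0) : Prop :=
  (∀ i, 0 < p i) ∧ ∀ j, ∑ i, p i * edgeMatrix G b i j = ∑ i, p j * edgeMatrix G b j i

/-- A representative of the ray of market-clearing prices (unique up to scaling for connected `G`
and strictly positive `b`). -/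
def graphPrice {m : ℕ} (G : Digraph (Fin m)) (b : (i : Fin m) → {j // G.Adj i j} → ℝ≥0) :
    Fin m → ℝ≥0 :=
  Classical.epsilon (IsGraphPrice G b)

open Classical in
/-- The `G`-mechanism: the `i`-indices are the edges out of `i`, and trader `s` receives
`rᵢ(aˢ, b) = pᵢ⁻¹ ∑ⱼ pⱼ aˢⱼᵢ`, where `b` is the sum of all offers and `p = p(b)`. -/
def graphMechanism {m : ℕ} (G : Digraph (Fin m)) : PreMechanism m where
  K i := {j // G.Adj i j}
  fintypeK _ := inferInstance
  ρ _ a _ s i :=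
    (graphPrice G (∑ t, a t) i)⁻¹ * ∑ j, graphPrice G (∑ t, a t) j * edgeMatrix G (a s) j i

/-- Mechanisms with the names of the indices disregarded. -/
abbrev Mechanism (m : ℕ) : Type 1 := Quotient (PreMechanism.relabelSetoid m)

/-- The set `𝔐_*` of minimal mechanisms. -/
def minimalMechanisms (m : ℕ) : Set (Mechanism m) :=
  {X | ∃ M : PreMechanism m, M.IsMinimal ∧ X = Quotient.mk _ M}

/-- The set `𝔐_g` of `G`-mechanisms of connected graphs. -/
def graphicalMechanisms (m : ℕ) : Set (Mechanism m) :=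
  {X | ∃ G : Digraph (Fin m), IsConnectedGraph G ∧ X = Quotient.mk _ (graphMechanism G)}

end ExchangeMechanism

end

/-!
Let `M` be a mechanism of the class. By aggregation and anonymity the return to an offer `a`
depends only on `a` and on the aggregate offer `b`, and it is additive in `a`; being nonnegative,
it is linear in `a` (`IsFair.ret_eq_sum_rate`). So `M` is described by the rates of return of its
indices at each `b`. Non-dissipation gives value-conserving prices, by separation of the subspace
of net trades from the standard simplex (`InClass.exists_isPrice`). Let `G` be the graph with an
edge from `i` to `j ≠ i` whenever `M` has an `ij`-index. Bundles of commodities are converted along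
edges of `G` only, so `G` is connected (`InClass.isConnectedGraph`), and pure indices, which exist on
all edges by flexibility, determine the prices up to scaling (`InClass.price_mul_eq_mul`).

The mechanism of `G` is in the class and no more complex than `M`
(`IsPureChoice.noMoreComplex`). It has one index per edge, while `M` has at least one pure index per
edge. It converts one unit into one unit along an edge at an aggregate offer with equal prices, so
it follows any walk in `G`; and a conversion in `M` takes at least as many steps as some walk
(`IsFair.exists_isLazyWalk`). For the price complexities, choose a pure index of `M` for every edge and put `ε` on all other indices.
Conservation says that the prices of `M` clear the matrix of its flows, and as `ε → 0` this matrix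
tends to the matrix of offers on the edges. By compactness and by uniqueness of clearing prices
(`tendsto_of_isClearing`) the prices of `M` tend to those of `G`. So if a price ratio of `G` depends
on an edge, then the ratio in `M` depends on the pure index chosen for this edge
(`IsPureChoice.isInfluential`).

If `M` is minimal, it follows that it has no more indices than `G` has edges, so it consists of the
chosen pure indices. Then conservation is the clearing equation of `G`, the prices of `M` are those
of `G`, and the returns agree (`IsPureChoice.isRelabelling`). There are finitely many graphs.
-/

noncomputable section

namespace ExchangeMechanism

/-! ### Clearing prices of a weight matrix -/

/-- `p` clears the weights `w`: at every vertex the inflow `∑ᵢ pᵢ wᵢⱼ` equals the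
outflow `∑ᵢ pⱼ wⱼᵢ`. No sign is imposed on `p`. -/
def IsClearing {ι : Type*} [Fintype ι] (w : ι → ι → ℝ) (p : ι → ℝ) : Prop :=
  ∀ j, ∑ i, p i * w i j = ∑ i, p j * w j i

section Clearing

variable {ι : Type*} [Fintype ι] {w : ι → ι → ℝ}

/-- The minimum principle: the zero set of a nonnegative clearing vector is closed under
predecessors in the graph of positive weights. -/
theorem IsClearing.eq_zero {q : ι → ℝ} (hq : IsClearing w q) (hw : ∀ i j, 0 ≤ w i j)
    (hc : ∀ i j, i ≠ j → Relation.TransGen (fun i j => 0 < w i j) i j)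
    (hq0 : ∀ i, 0 ≤ q i) {j : ι} (hj : q j = 0) (i : ι) : q i = 0 := by
  have key : ∀ i k, 0 < w i k → q k = 0 → q i = 0 := by
    intro i k hik hk
    have h := hq k
    simp only [hk, zero_mul, Finset.sum_const_zero] at h
    have h' := (Finset.sum_eq_zero_iff_of_nonneg
      (fun l _ => mul_nonneg (hq0 l) (hw l k))).1 h i (Finset.mem_univ i)
    exact (mul_eq_zero.1 h').resolve_right hik.ne'
  by_cases hij : i = j
  · rw [hij, hj]
  · refine Relation.TransGen.head_induction_on (motive := fun a _ => q a = 0) (hc i j hij) ?_ ?_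
    · intro a h; exact key a j h hj
    · intro a c h _ hc; exact key a c h hc

/-- Clearing vectors are proportional to any positive one. -/
theorem IsClearing.mul_eq_mul {p q : ι → ℝ} (hp : IsClearing w p) (hq : IsClearing w q)
    (hw : ∀ i j, 0 ≤ w i j)
    (hc : ∀ i j, i ≠ j → Relation.TransGen (fun i j => 0 < w i j) i j)
    (hp0 : ∀ i, 0 < p i) (i j : ι) : q i * p j = q j * p i := by
  have : Nonempty ι := ⟨i⟩
  obtain ⟨k, hk⟩ := Finite.exists_min (fun i => q i / p i)
  -- subtracting the largest multiple of `p` below `q` leaves a nonnegative vector with a zero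
  have hd : IsClearing w (fun i => q i - q k / p k * p i) := by
    intro l
    have h1 := hp l
    have h2 := hq l
    simp only [sub_mul, Finset.sum_sub_distrib, mul_assoc, ← Finset.mul_sum] at *
    rw [h1, h2]
  have hz := hd.eq_zero hw hc (fun l => by
    have := (le_div_iff₀ (hp0 l)).1 (hk l)
    simpa using this) (j := k) (by
      have := (hp0 k).ne'
      field_simp
      simp)
  have hi := hz i
  have hj := hz j
  simp only [sub_eq_zero] at hi hj
  rw [hi, hj]; ring

/-- The clearing equations have a nonzero solution, the matrix of the system having zero column
sums; its absolute value is a solution too, and is positive by the minimum principle. -/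
theorem exists_isClearing_pos (hw : ∀ i j, 0 ≤ w i j)
    (hc : ∀ i j, i ≠ j → Relation.TransGen (fun i j => 0 < w i j) i j) :
    ∃ p : ι → ℝ, (∀ i, 0 < p i) ∧ IsClearing w p := by
  classical
  cases isEmpty_or_nonempty ι with
  | inl h => exact ⟨fun _ => 1, fun i => h.elim i, fun i => h.elim i⟩
  | inr hne =>
  let A : Matrix ι ι ℝ := fun j i => w i j - if i = j then ∑ k, w j k else 0
  have hA : ∀ v : ι → ℝ, A.mulVec v = 0 ↔ IsClearing w v := by
    intro v
    rw [funext_iff]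
    refine forall_congr' fun j => ?_
    simp only [A, Matrix.mulVec, dotProduct, sub_mul, Finset.sum_sub_distrib, ite_mul, zero_mul,
      Finset.sum_ite_eq', Finset.mem_univ, if_true, Pi.zero_apply, sub_eq_zero]
    simp only [Finset.sum_mul, mul_comm (v _)]
  have hone : Matrix.vecMul (fun _ => (1 : ℝ)) A = 0 := by
    ext i
    simp [A, Matrix.vecMul, dotProduct, Finset.sum_sub_distrib]
  have hdet : A.det = 0 := Matrix.exists_vecMul_eq_zero_iff.1 ⟨fun _ => 1, by
    intro h
    simpa using congrFun h hne.some, hone⟩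
  obtain ⟨v, hv0, hv⟩ := Matrix.exists_mulVec_eq_zero_iff.2 hdet
  rw [hA] at hv
  have hle : ∀ j ∈ Finset.univ, ∑ i, |v j| * w j i ≤ ∑ i, |v i| * w i j := by
    intro j _
    calc ∑ i, |v j| * w j i = |∑ i, v j * w j i| := by
          rw [← Finset.mul_sum, ← Finset.mul_sum, abs_mul,
            abs_of_nonneg (Finset.sum_nonneg fun i _ => hw j i)]
      _ = |∑ i, v i * w i j| := by rw [hv j]
      _ ≤ ∑ i, |v i * w i j| := Finset.abs_sum_le_sum_abs _ _
      _ = ∑ i, |v i| * w i j := by simp only [abs_mul, abs_of_nonneg (hw _ _)]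
  -- the inequalities are equalities, since both sides have the same sum over all vertices
  have habs : IsClearing w (fun i => |v i|) := fun j =>
    ((Finset.sum_eq_sum_iff_of_le hle).1 Finset.sum_comm j (Finset.mem_univ j)).symm
  refine ⟨fun i => |v i|, fun i => ?_, habs⟩
  refine lt_of_le_of_ne (abs_nonneg _) fun h => hv0 (funext fun j => ?_)
  exact abs_eq_zero.1 (habs.eq_zero hw hc (fun _ => abs_nonneg _) h.symm j)

end Clearing

/-! ### Additive functions on an interval -/

/-- Cauchy's equation on `[0, B]`: an additive nonnegative function is monotone, so linear. -/
theorem mul_eq_mul_of_additive {g : ℝ≥0 → ℝ≥0} {B : ℝ≥0}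
    (hg : ∀ x y, x + y ≤ B → g (x + y) = g x + g y) {x : ℝ≥0} (hx : x ≤ B) :
    B * g x = x * g B := by
  rcases eq_or_ne B 0 with rfl | hB
  · have : x = 0 := le_antisymm hx zero_le
    simp [this]
  have hB0 : (0 : ℝ) < B := by exact_mod_cast pos_iff_ne_zero.2 hB
  have h0 : g 0 = 0 := by
    have := hg 0 0 (by simp)
    simpa using this
  have hmono : ∀ x y, x ≤ y → y ≤ B → g x ≤ g y := by
    intro x y hxy hy
    have := hg x (y - x) (by rwa [add_tsub_cancel_of_le hxy])
    rw [add_tsub_cancel_of_le hxy] at this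
    rw [this]; exact le_self_add
  have hnat : ∀ (n : ℕ) (x : ℝ≥0), n * x ≤ B → g (n * x) = n * g x := by
    intro n x
    induction n with
    | zero => simp [h0]
    | succ n ih =>
      intro h
      have e : ((n + 1 : ℕ) : ℝ≥0) * x = n * x + x := by push_cast; ring
      rw [e] at h ⊢
      rw [hg _ _ h, ih (le_self_add.trans h)]
      push_cast; ring
  have hlow : ∀ x, x ≤ B → (x * g B : ℝ) ≤ B * g x := by
    intro x hx
    by_contra hlt
    push Not at hlt
    obtain ⟨n, hn⟩ := exists_nat_gt ((B * g B : ℝ) / (x * g B - B * g x))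
    rw [div_lt_iff₀ (sub_pos.2 hlt)] at hn
    have hn0 : n ≠ 0 := by
      rintro rfl
      have : (0 : ℝ) ≤ B * g B := by positivity
      simp only [Nat.cast_zero, zero_mul] at hn
      linarith
    have hn' : (0 : ℝ) < n := by exact_mod_cast Nat.pos_of_ne_zero hn0
    have hnn : (n : ℝ≥0) ≠ 0 := by exact_mod_cast hn0
    set k := ⌊(n * x / B : ℝ)⌋₊ with hk
    have hk1 : (k : ℝ) * B ≤ n * x := by
      have := Nat.floor_le (show (0 : ℝ) ≤ n * x / B by positivity)
      rwa [← hk, le_div_iff₀ hB0] at this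
    have hk2 : (n * x : ℝ) < (k + 1) * B := by
      have := Nat.lt_floor_add_one (n * x / B : ℝ)
      rwa [← hk, div_lt_iff₀ hB0] at this
    have hkx : (k : ℝ≥0) * (B / n) ≤ x := by
      rw [← NNReal.coe_le_coe]
      push_cast
      rw [← mul_div_assoc, div_le_iff₀ hn']
      linarith
    have e1 : g B = n * g (B / n) := by
      have := hnat n (B / n) (by rw [mul_div_cancel₀ _ hnn])
      rwa [mul_div_cancel₀ _ hnn] at this
    have e2 := hnat k (B / n) (hkx.trans hx)
    have e3 : (k : ℝ≥0) * g (B / n) ≤ g x := e2 ▸ hmono _ _ hkx hx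
    have e1' : (g B : ℝ) = n * g (B / n) := by exact_mod_cast e1
    have e3' : (k : ℝ) * g (B / n) ≤ g x := by exact_mod_cast e3
    have e4 : (0 : ℝ) ≤ g B := NNReal.coe_nonneg _
    have e5 : (k : ℝ) * g B ≤ n * g x := by rw [e1']; nlinarith
    have e6 : (n * x : ℝ) * g B ≤ (k + 1) * B * g B := mul_le_mul_of_nonneg_right hk2.le e4
    have e7 := mul_le_mul_of_nonneg_left e5 hB0.le
    nlinarith
  rw [← NNReal.coe_inj]
  push_cast
  refine le_antisymm ?_ (hlow x hx)
  -- the lower bound at the complement `B - x` is the upper bound at `x`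
  have h1 := hlow (B - x) tsub_le_self
  have h2 := hg x (B - x) (by rw [add_tsub_cancel_of_le hx])
  rw [add_tsub_cancel_of_le hx] at h2
  have h3 : (g B : ℝ) = g x + g (B - x) := by exact_mod_cast h2
  rw [NNReal.coe_sub hx] at h1
  nlinarith

namespace PreMechanism

/-! ### Returns are linear in the offer -/

variable {m : ℕ} {M : PreMechanism m}

/-- The conditions of the class that are equations between returns. They suffice for returns to be
linear in the offer. -/
structure IsFair (M : PreMechanism m) : Prop where
  exchange : M.IsExchange
  anonymity : M.Anonymity
  aggregation : M.Aggregation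
  invariance : M.Invariance

theorem InClass.isFair (hM : M.InClass) : M.IsFair :=
  ⟨hM.exchange, hM.anonymity, hM.aggregation, hM.invariance⟩

theorem rho_congr {n : ℕ} {a a' : Fin n → M.Offer} (h : a = a') (ha : M.PosAgg a)
    (ha' : M.PosAgg a') : M.ρ n a ha = M.ρ n a' ha' := by
  subst h; rfl

theorem posAgg_sub (a : M.Offer) (b : M.State) : M.PosAgg ![a, b.1 - a] := by
  intro i h
  have : b.1 i h ≤ a i h + (b.1 i h - a i h) := le_add_tsub
  simpa [Fin.sum_univ_two] using (b.2 i h).trans_le this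

variable (M) in
/-- The return to an offer `a` when the offers of all traders sum to `b`. It is meaningful only
for `a ≤ b`; otherwise the truncated difference `b - a` makes the true sum larger than `b`. -/
def ret (a : M.Offer) (b : M.State) : Fin m → ℝ≥0 := M.ρ 2 ![a, b.1 - a] (posAgg_sub a b) 0

/-- The sum of a tuple of offers, as a strictly positive offer. -/
def sumState {n : ℕ} (a : Fin n → M.Offer) (ha : M.PosAgg a) : M.State :=
  ⟨∑ s, a s, fun i h => by simpa [Finset.sum_apply] using ha i h⟩

theorem sum_mergeLast {X : Type} [AddCommMonoid X] {n : ℕ} (x : Fin (n + 2) → X) :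
    ∑ s, mergeLast x s = ∑ s, x s := by
  simp [mergeLast, Fin.sum_univ_castSucc, add_assoc]

theorem mergeLast_zero {X : Type} [Add X] {n : ℕ} (x : Fin (n + 3) → X) :
    mergeLast x 0 = x 0 := by
  have : (0 : Fin (n + 2)) = Fin.castSucc 0 := rfl
  rw [mergeLast, this, Fin.snoc_castSucc]
  rfl

theorem posAgg_mergeLast {n : ℕ} {a : Fin (n + 2) → M.Offer} (ha : M.PosAgg a) :
    M.PosAgg (mergeLast a) := by
  intro i h
  have := congrFun (congrFun (sum_mergeLast a) i) h
  simp only [Finset.sum_apply] at this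
  rw [this]
  exact ha i h

namespace IsFair

variable (hM : M.IsFair)
include hM

theorem rho_zero_eq_ret {n : ℕ} (a : Fin (n + 2) → M.Offer) (ha : M.PosAgg a) :
    M.ρ (n + 2) a ha 0 = M.ret (a 0) (sumState a ha) := by
  induction n with
  | zero =>
    have : a = ![a 0, (sumState a ha).1 - a 0] := by
      funext s
      fin_cases s
      · rfl
      · simp [sumState, Fin.sum_univ_two]
    exact congrFun (rho_congr this _ _) 0
  | succ n ih =>
    have h1 := congrFun (hM.aggregation (n + 1) a ha (posAgg_mergeLast ha)) 0
    rw [mergeLast_zero] at h1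
    rw [← h1, ih, mergeLast_zero]
    congr 1
    exact Subtype.ext (sum_mergeLast a)

/-- With at least two traders, each return depends only on the trader's own offer and on the
sum of all offers. -/
theorem rho_eq_ret {n : ℕ} (a : Fin (n + 2) → M.Offer) (ha : M.PosAgg a) (s : Fin (n + 2)) :
    M.ρ (n + 2) a ha s = M.ret (a s) (sumState a ha) := by
  have hsum : ∑ t, a (Equiv.swap 0 s t) = ∑ t, a t := Equiv.sum_comp (Equiv.swap 0 s) a
  have ha' : M.PosAgg (fun t => a (Equiv.swap 0 s t)) := by
    intro i h
    have := congrFun (congrFun hsum i) h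
    simp only [Finset.sum_apply] at this
    rw [this]
    exact ha i h
  have h1 := congrFun (hM.anonymity _ a ha (Equiv.swap 0 s) ha') 0
  rw [hM.rho_zero_eq_ret] at h1
  simp only [Equiv.swap_apply_left] at h1
  rw [← h1]
  congr 1
  exact Subtype.ext hsum

theorem ret_add {a a' : M.Offer} {b : M.State} (h : a + a' ≤ b.1) :
    M.ret (a + a') b = M.ret a b + M.ret a' b := by
  have hsum : ∑ s, ![b.1 - (a + a'), a, a'] s = b.1 := by
    rw [Fin.sum_univ_three]
    simpa [add_assoc] using tsub_add_cancel_of_le h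
  have hpos : M.PosAgg ![b.1 - (a + a'), a, a'] := by
    intro i h
    have := congrFun (congrFun hsum i) h
    simp only [Finset.sum_apply] at this
    rw [this]
    exact b.2 i h
  have h1 := congrFun (hM.aggregation 1 _ hpos (posAgg_mergeLast hpos)) 1
  have h2 := hM.rho_eq_ret _ (posAgg_mergeLast hpos) 1
  have e1 : sumState _ hpos = b := Subtype.ext hsum
  have e2 : sumState _ (posAgg_mergeLast hpos) = b := Subtype.ext ((sum_mergeLast _).trans hsum)
  have h3 : mergeLast (M.ρ (1 + 2) _ hpos) 1 = M.ρ 3 _ hpos 1 + M.ρ 3 _ hpos 2 := rfl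
  rw [h2, h3, hM.rho_eq_ret, hM.rho_eq_ret, e1, e2] at h1
  exact h1

theorem ret_zero (b : M.State) : M.ret 0 b = 0 := by
  have := hM.ret_add (a := 0) (a' := 0) (b := b) (by simp)
  simpa using this

theorem ret_self (b : M.State) : M.ret b.1 b = M.total b.1 := by
  have hpos : M.PosAgg ![b.1, 0] := by
    intro i h
    simpa [Fin.sum_univ_two] using b.2 i h
  have h := hM.exchange 2 ![b.1, 0] hpos
  have e : sumState _ hpos = b := Subtype.ext (by simp [sumState])
  rw [Fin.sum_univ_two, hM.rho_eq_ret, hM.rho_eq_ret, Fin.sum_univ_two, e] at h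
  have ht : M.total 0 = 0 := by funext i; simp [total]
  simpa [hM.ret_zero, ht] using h

/-- The case of a single trader, who receives the own offer back, is included. -/
theorem rho_eq_ret' {n : ℕ} (a : Fin n → M.Offer) (ha : M.PosAgg a) (s : Fin n) :
    M.ρ n a ha s = M.ret (a s) (sumState a ha) := by
  match n, a, ha, s with
  | 1, a, ha, s =>
    have h := hM.exchange 1 a ha
    have e : a s = (sumState a ha).1 := by simp [sumState, Subsingleton.elim s 0]
    rw [e, hM.ret_self, ← e]
    simpa [Subsingleton.elim s 0] using h
  | n + 2, a, ha, s => exact hM.rho_eq_ret a ha s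

theorem ret_smul {t : ℝ≥0} (ht : 0 < t) (a : M.Offer) (b : M.State) :
    M.ret (t • a) (b.smul t ht) = t • M.ret a b := by
  have e : (fun s => M.rescale (fun _ => t) (![a, b.1 - a] s)) =
      ![t • a, (b.smul t ht).1 - t • a] := by
    funext s
    fin_cases s
    · rfl
    · funext i h
      simp [rescale, State.smul, mul_tsub]
  have hpos : M.PosAgg (fun s => M.rescale (fun _ => t) (![a, b.1 - a] s)) := by
    rw [e]; exact posAgg_sub _ _
  have h := congrFun (hM.invariance 2 _ (posAgg_sub a b) (fun _ => t) (fun _ => ht) hpos) 0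
  rw [rho_congr e hpos (posAgg_sub _ _)] at h
  exact h

end IsFair

theorem offer_eq_sum (a : M.Offer) :
    a = ∑ c : Σ i, M.K i, a c.1 c.2 • M.unitOffer c.2 := by
  classical
  funext i h
  rw [Finset.sum_apply, Finset.sum_apply, Finset.sum_eq_single ⟨i, h⟩]
  · simp [unitOffer]
  · rintro ⟨i', h'⟩ _ hne
    by_cases hi : i' = i
    · subst hi
      have : h ≠ h' := fun e => hne (by rw [e])
      simp [unitOffer, this]
    · simp [unitOffer, Pi.single_eq_of_ne (Ne.symm hi)]
  · simp

theorem smul_unitOffer_le {a b : M.Offer} (hab : a ≤ b) {i : Fin m} (h : M.K i) :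
    a i h • M.unitOffer h ≤ b := by
  refine le_trans ?_ hab
  conv_rhs => rw [offer_eq_sum a]
  exact Finset.single_le_sum (f := fun c : Σ i, M.K i => a c.1 c.2 • M.unitOffer c.2)
    (fun _ _ => zero_le) (Finset.mem_univ (⟨i, h⟩ : Σ i, M.K i))

variable (M) in
/-- The return per unit offered on the index `h` at the aggregate offer `b`. -/
def rate (b : M.State) {i : Fin m} (h : M.K i) (j : Fin m) : ℝ≥0 :=
  M.ret (b.1 i h • M.unitOffer h) b j / b.1 i h

namespace IsFair

variable (hM : M.IsFair)
include hM

theorem ret_smul_unitOffer (b : M.State) {i : Fin m} (h : M.K i) (j : Fin m) {x : ℝ≥0}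
    (hx : x ≤ b.1 i h) : M.ret (x • M.unitOffer h) b j = x * M.rate b h j := by
  have hadd : ∀ x y : ℝ≥0, x + y ≤ b.1 i h → M.ret ((x + y) • M.unitOffer h) b j =
      M.ret (x • M.unitOffer h) b j + M.ret (y • M.unitOffer h) b j := by
    intro x y hxy
    rw [add_smul, hM.ret_add, Pi.add_apply]
    rw [← add_smul]
    exact (smul_le_smul_of_nonneg_right hxy zero_le).trans (smul_unitOffer_le le_rfl h)
  have := mul_eq_mul_of_additive (g := fun x => M.ret (x • M.unitOffer h) b j) hadd hx
  have hb := (b.2 i h).ne'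
  rw [rate, ← mul_div_assoc, ← this, mul_div_cancel_left₀ _ hb]

theorem ret_sum {ι : Type} (s : Finset ι) (f : ι → M.Offer) (b : M.State)
    (h : ∑ c ∈ s, f c ≤ b.1) : M.ret (∑ c ∈ s, f c) b = ∑ c ∈ s, M.ret (f c) b := by
  classical
  induction s using Finset.induction_on with
  | empty => simpa using hM.ret_zero b
  | insert c s hc ih =>
    rw [Finset.sum_insert hc] at h ⊢
    rw [Finset.sum_insert hc, hM.ret_add h, ih (le_trans le_add_self h)]

theorem ret_eq_sum_rate {a : M.Offer} {b : M.State} (hab : a ≤ b.1) (j : Fin m) :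
    M.ret a b j = ∑ i, ∑ h, a i h * M.rate b h j := by
  have h1 := hM.ret_sum Finset.univ (fun c : Σ i, M.K i => a c.1 c.2 • M.unitOffer c.2) b
    (by rw [← offer_eq_sum]; exact hab)
  rw [← offer_eq_sum] at h1
  rw [h1, Finset.sum_apply, Fintype.sum_sigma]
  exact Finset.sum_congr rfl fun i _ => Finset.sum_congr rfl fun h _ =>
    hM.ret_smul_unitOffer b h j (hab i h)

theorem rate_smul {t : ℝ≥0} (ht : 0 < t) (b : M.State) {i : Fin m} (h : M.K i) (j : Fin m) :
    M.rate (b.smul t ht) h j = M.rate b h j := by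
  have e : (b.smul t ht).1 i h • M.unitOffer h = t • (b.1 i h • M.unitOffer h) := by
    rw [smul_smul]; rfl
  rw [rate, e, hM.ret_smul ht]
  change t * _ / (t * _) = _
  rw [mul_div_mul_left _ _ ht.ne', rate]

theorem netTrade_eq (a : M.Offer) (b : M.State) (j : Fin m) :
    M.netTrade a b j = ((∑ i, ∑ h, a i h * M.rate b h j : ℝ≥0) : ℝ) - M.total a j := by
  have h := hM.ret_eq_sum_rate (M.le_factor_smul a b) j
  simp only [hM.rate_smul] at h
  rw [← h]
  rfl

theorem isIndex_iff {i : Fin m} (h : M.K i) (j : Fin m) :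
    M.IsIndex j h ↔ ∃ b, 0 < M.rate b h j := by
  have hone : M.unitOffer h i h = 1 := by simp [unitOffer]
  constructor
  · rintro ⟨a, ha, hpos⟩
    refine ⟨sumState _ ha, ?_⟩
    rw [hM.rho_eq_ret] at hpos
    have hle : (1 : ℝ≥0) ≤ (sumState _ ha).1 i h := by
      simp [sumState, hone]
    have := hM.ret_smul_unitOffer (sumState _ ha) h j hle
    rw [one_smul, one_mul] at this
    rw [← this]
    exact hpos
  · rintro ⟨b, hb⟩
    set b' := b.smul (M.factor (M.unitOffer h) b) (M.factor_pos _ _) with hb'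
    have hle : M.unitOffer h ≤ b'.1 := M.le_factor_smul _ b
    refine ⟨b'.1 - M.unitOffer h, posAgg_sub _ b', ?_⟩
    change 0 < M.ret (M.unitOffer h) b' j
    have := hM.ret_smul_unitOffer b' h j (x := 1) (hone ▸ hle i h)
    rw [one_smul, one_mul] at this
    rwa [this, hb', hM.rate_smul]

theorem rate_eq_zero_of_isPureIndex {i j k : Fin m} {h : M.K i} (hh : M.IsPureIndex j h)
    (hk : k ≠ j) (b : M.State) : M.rate b h k = 0 := by
  by_contra hne
  obtain ⟨a, ha, hpos⟩ := (hM.isIndex_iff h k).2 ⟨b, pos_iff_ne_zero.2 hne⟩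
  exact hpos.ne' (hh.2 a ha k hk)

/-- Conservation in terms of rates. -/
theorem sum_mul_rate (b : M.State) (j : Fin m) :
    ∑ i, ∑ h, b.1 i h * M.rate b h j = ∑ h, b.1 j h := by
  rw [← hM.ret_eq_sum_rate le_rfl, hM.ret_self]
  rfl

theorem isPrice_iff (b : M.State) (p : Fin m → ℝ) :
    M.IsPrice b p ↔ (∀ i, 0 < p i) ∧
      ∀ (i : Fin m) (h : M.K i), ∑ j, p j * (M.rate b h j : ℝ) = p i := by
  refine and_congr_right fun _ => ?_
  have key : ∀ a : M.Offer, ∑ i, p i * M.netTrade a b i =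
      ∑ i, ∑ h : M.K i, (a i h : ℝ) * (∑ j, p j * (M.rate b h j : ℝ) - p i) := by
    intro a
    simp only [hM.netTrade_eq, mul_sub, Finset.sum_sub_distrib, total]
    push_cast
    congr 1
    · simp only [Finset.mul_sum]
      rw [Finset.sum_comm]
      refine Finset.sum_congr rfl fun i _ => ?_
      rw [Finset.sum_comm]
      refine Finset.sum_congr rfl fun h _ => Finset.sum_congr rfl fun j _ => ?_
      ring
    · simp only [Finset.mul_sum, mul_comm]
  constructor
  · intro H i h
    have := H (M.unitOffer h)
    rw [key, ← Fintype.sum_sigma', Finset.sum_eq_single ⟨i, h⟩] at this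
    · simpa [unitOffer, sub_eq_zero] using this
    · rintro ⟨i', h'⟩ _ hne
      by_cases hi : i' = i
      · subst hi
        have : h' ≠ h := fun e => hne (by rw [e])
        simp [unitOffer, this]
      · simp [unitOffer, Pi.single_eq_of_ne hi]
    · simp
  · intro H a
    rw [key]
    simp [H]

end IsFair

end PreMechanism

/-! ### Continuity of clearing prices -/

/-- Normalized clearing prices depend continuously on the weights, at connected weights. -/
theorem tendsto_of_isClearing {ι : Type*} [Fintype ι] {w : ι → ι → ℝ} {p : ι → ℝ}
    {wn : ℕ → ι → ι → ℝ} {pn : ℕ → ι → ℝ}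
    (hw : ∀ i j, 0 ≤ w i j)
    (hc : ∀ i j, i ≠ j → Relation.TransGen (fun i j => 0 < w i j) i j)
    (hp : IsClearing w p) (hp0 : ∀ i, 0 < p i) (hp1 : ∑ i, p i = 1)
    (hwn : ∀ i j, Filter.Tendsto (fun n => wn n i j) Filter.atTop (nhds (w i j)))
    (hpn : ∀ n, IsClearing (wn n) (pn n)) (hpn1 : ∀ n, pn n ∈ stdSimplex ℝ ι) :
    Filter.Tendsto pn Filter.atTop (nhds p) := by
  refine Filter.tendsto_of_subseq_tendsto fun ns hns => ?_
  obtain ⟨q, hq, φ, hφ, hlim⟩ :=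
    (isCompact_stdSimplex ℝ ι).tendsto_subseq (x := fun n => pn (ns n)) fun n => hpn1 (ns n)
  refine ⟨φ, ?_⟩
  have hlim' : ∀ i, Filter.Tendsto (fun n => pn (ns (φ n)) i) Filter.atTop (nhds (q i)) :=
    fun i => (tendsto_pi_nhds.1 hlim) i
  have hw' : ∀ i j, Filter.Tendsto (fun n => wn (ns (φ n)) i j) Filter.atTop (nhds (w i j)) :=
    fun i j => (hwn i j).comp (hns.comp hφ.tendsto_atTop)
  have hqc : IsClearing w q := by
    intro j
    refine tendsto_nhds_unique
      (tendsto_finsetSum Finset.univ fun i _ => (hlim' i).mul (hw' i j)) ?_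
    simp only [hpn (ns (φ _)) j]
    exact tendsto_finsetSum Finset.univ fun i _ => (hlim' j).mul (hw' j i)
  have hqp : q = p := by
    funext i
    have h := hp.mul_eq_mul hqc hw hc hp0 i
    have h' : ∑ j, q i * p j = ∑ j, q j * p i := Finset.sum_congr rfl fun j _ => h j
    rw [← Finset.mul_sum, ← Finset.sum_mul, hp1, hq.2] at h'
    linarith
  rw [← hqp]
  exact hlim

namespace PreMechanism

variable {m : ℕ} {M : PreMechanism m}

/-! ### Existence of prices -/

/-- The net trades at `b` form a linear subspace, because `b` itself has net trade zero. By
non-dissipation it misses the standard simplex, and a hyperplane that separates the two gives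
the prices. -/
theorem InClass.exists_isPrice (hM : M.InClass) (b : M.State) : ∃ p, M.IsPrice b p := by
  have hF := hM.isFair
  let T : ((c : Σ i, M.K i) → ℝ) →ₗ[ℝ] (Fin m → ℝ) :=
    Fintype.linearCombination ℝ
      (fun c : Σ i, M.K i => fun j => (M.rate b c.2 j : ℝ) - Pi.single (M := fun _ => ℝ) c.1 1 j)
  have hT : ∀ x j, T x j = ∑ c : Σ i, M.K i,
      x c * ((M.rate b c.2 j : ℝ) - Pi.single (M := fun _ => ℝ) c.1 1 j) := by
    intro x j
    simp [T, Fintype.linearCombination_apply, Finset.sum_apply]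
  have hTtrade : ∀ (a : M.Offer) j, T (fun c => a c.1 c.2) j = M.netTrade a b j := by
    intro a j
    rw [hT, hF.netTrade_eq, Fintype.sum_sigma]
    simp only [mul_sub, Finset.sum_sub_distrib, total]
    push_cast
    congr 1
    rw [Finset.sum_eq_single j]
    · simp
    · intro i _ hi
      simp [Pi.single_eq_of_ne (Ne.symm hi)]
    · simp
  have hTb : T (fun c => b.1 c.1 c.2) = 0 := by
    funext j
    rw [hTtrade, hF.netTrade_eq, hF.sum_mul_rate]
    simp [total]
  -- every coefficient vector can be made nonnegative by adding a multiple of `b`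
  have hrange : ∀ x, ∃ a : M.Offer, T x = M.netTrade a b := by
    intro x
    let t : ℝ := ∑ c : Σ i, M.K i, |x c| / b.1 c.1 c.2
    have ht : ∀ c, 0 ≤ x c + t * b.1 c.1 c.2 := by
      intro c
      have hb : (0 : ℝ) < b.1 c.1 c.2 := by exact_mod_cast b.2 c.1 c.2
      have h1 : |x c| / b.1 c.1 c.2 ≤ t :=
        Finset.single_le_sum (f := fun c : Σ i, M.K i => |x c| / (b.1 c.1 c.2 : ℝ))
          (fun c _ => by positivity) (Finset.mem_univ c)
      rw [div_le_iff₀ hb] at h1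
      linarith [neg_abs_le (x c)]
    let a : M.Offer := fun i h => NNReal.mk (x ⟨i, h⟩ + t * b.1 i h) (ht ⟨i, h⟩)
    refine ⟨a, ?_⟩
    funext j
    rw [← hTtrade]
    have : (fun c : Σ i, M.K i => x c + t * (b.1 c.1 c.2 : ℝ)) =
        x + t • (fun c => (b.1 c.1 c.2 : ℝ)) := rfl
    change T x j = T (fun c : Σ i, M.K i => x c + t * (b.1 c.1 c.2 : ℝ)) j
    rw [this, map_add, map_smul, hTb]
    simp
  have hND : ∀ a : M.Offer, (∀ j, M.netTrade a b j ≤ 0) → ∀ j, M.netTrade a b j = 0 := by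
    intro a hle j
    set b' := b.smul (M.factor a b) (M.factor_pos a b)
    have hν : ∀ j, M.netTrade a b j = (M.ret a b' j : ℝ) - M.total a j := fun _ => rfl
    rcases hM.nonDissipation 2 ![a, b'.1 - a] (posAgg_sub a b') 0 with h | ⟨i, hi⟩
    · change M.ret a b' = M.total a at h
      rw [hν, h, sub_self]
    · change M.total a i < M.ret a b' i at hi
      have h1 := hle i
      rw [hν] at h1
      have h2 : (M.total a i : ℝ) < M.ret a b' i := by exact_mod_cast hi
      linarith
  have hdisj : Disjoint (stdSimplex ℝ (Fin m)) (LinearMap.range T : Set (Fin m → ℝ)) := by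
    rw [Set.disjoint_left]
    rintro y ⟨hy0, hy1⟩ ⟨x, rfl⟩
    obtain ⟨a, ha⟩ := hrange (-x)
    rw [map_neg] at ha
    have hz := hND a (fun j => by
      rw [← ha]; simpa using hy0 j)
    have : ∑ j, T x j = 0 := Finset.sum_eq_zero fun j _ => by
      have h := hz j
      rw [← ha] at h
      simpa using h
    linarith
  obtain ⟨f, u, v, hfu, huv, hfv⟩ := geometric_hahn_banach_compact_closed
    (convex_stdSimplex ℝ (Fin m)) (isCompact_stdSimplex ℝ (Fin m))
    (LinearMap.range T).convex (Submodule.closed_of_finiteDimensional _) hdisj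
  have hv0 : v < 0 := by
    have := hfv 0 (Submodule.zero_mem _)
    simpa using this
  -- a functional that is bounded below on a subspace vanishes there
  have hf0 : ∀ x, f (T x) = 0 := by
    intro x
    by_contra hne
    have := hfv (T ((v / f (T x)) • x)) ⟨_, rfl⟩
    rw [map_smul, map_smul, smul_eq_mul, div_mul_cancel₀ _ hne] at this
    exact lt_irrefl _ this
  have hfsum : ∀ y : Fin m → ℝ, f y = ∑ i, f (Pi.single i 1) * y i := by
    intro y
    conv_lhs => rw [pi_eq_sum_univ' y]
    rw [map_sum]
    refine Finset.sum_congr rfl fun i _ => ?_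
    rw [map_smul, smul_eq_mul, mul_comm]
  refine ⟨fun i => -f (Pi.single i 1), fun i => ?_, fun a => ?_⟩
  · have := hfu _ (single_mem_stdSimplex ℝ i)
    linarith
  · have h := hf0 (fun c => (a c.1 c.2 : ℝ))
    rw [hfsum] at h
    simp only [hTtrade] at h
    simp only [neg_mul, Finset.sum_neg_distrib, h, neg_zero]

/-! ### The graph of a mechanism -/

variable (M) in
/-- The graph of a mechanism: an edge from `i` to `j ≠ i` for every pair with an `ij`-index. -/
def graph : Digraph (Fin m) := ⟨fun i j => i ≠ j ∧ ∃ h : M.K i, M.IsIndex j h⟩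

/-- A lazy walk of length `t`: at each step it stays or follows an edge. -/
def IsLazyWalk (G : Digraph (Fin m)) (y : ℕ → Fin m) (t : ℕ) : Prop :=
  ∀ r < t, y r = y (r + 1) ∨ G.Adj (y r) (y (r + 1))

theorem IsLazyWalk.reflTransGen {G : Digraph (Fin m)} {y : ℕ → Fin m} {t : ℕ}
    (hy : IsLazyWalk G y t) : Relation.ReflTransGen G.Adj (y 0) (y t) := by
  induction t with
  | zero => exact .refl
  | succ t ih =>
    have h := ih fun r hr => hy r (hr.trans (Nat.lt_succ_self t))
    rcases hy t (Nat.lt_succ_self t) with e | e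
    · rwa [← e]
    · exact h.tail e

/-- A conversion moves the support of a commodity bundle along edges of the graph. -/
theorem IsFair.exists_adj_of_converts (hM : M.IsFair) {v w : Fin m → ℝ≥0} (h : M.Converts v w)
    {k : Fin m} (hk : 0 < w k) : ∃ l, 0 < v l ∧ (l = k ∨ M.graph.Adj l k) := by
  obtain ⟨a, b, hav, hw⟩ := h
  rcases eq_or_ne (v k) 0 with hvk | hvk
  · have hak : M.total a k = 0 := le_antisymm (hvk ▸ hav k) zero_le
    have h1 := hw k
    rw [hM.netTrade_eq, hvk, hak] at h1
    have h2 : w k = ∑ i, ∑ h, a i h * M.rate b h k := by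
      rw [← NNReal.coe_inj, h1]; simp
    rw [h2] at hk
    obtain ⟨l, -, hl⟩ := Finset.exists_ne_zero_of_sum_ne_zero hk.ne'
    obtain ⟨h, -, hh⟩ := Finset.exists_ne_zero_of_sum_ne_zero hl
    have hah : 0 < a l h := pos_iff_ne_zero.2 (left_ne_zero_of_mul hh)
    have hvl : 0 < v l := hah.trans_le (le_trans
      (Finset.single_le_sum (f := fun h => a l h) (fun _ _ => zero_le) (Finset.mem_univ h))
      (hav l))
    refine ⟨l, hvl, Or.inr ⟨?_, h, (hM.isIndex_iff h k).2
      ⟨b, pos_iff_ne_zero.2 (right_ne_zero_of_mul hh)⟩⟩⟩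
    rintro rfl
    exact hvl.ne' hvk
  · exact ⟨k, pos_iff_ne_zero.2 hvk, Or.inl rfl⟩

theorem IsFair.exists_isLazyWalk (hM : M.IsFair) {i : Fin m} {x : ℕ → Fin m → ℝ≥0} {t : ℕ}
    (h0 : x 0 = Pi.single i 1) (hx : ∀ s < t, M.Converts (x s) (x (s + 1))) {k : Fin m}
    (hk : 0 < x t k) : ∃ y : ℕ → Fin m, y 0 = i ∧ y t = k ∧ IsLazyWalk M.graph y t := by
  induction t generalizing k with
  | zero =>
    refine ⟨fun _ => i, rfl, ?_, fun r hr => absurd hr (Nat.not_lt_zero r)⟩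
    by_contra hne
    rw [h0, Pi.single_eq_of_ne (Ne.symm hne)] at hk
    exact lt_irrefl _ hk
  | succ t ih =>
    obtain ⟨l, hl, hlk⟩ := hM.exists_adj_of_converts (hx t (Nat.lt_succ_self t)) hk
    obtain ⟨y, hy0, hyt, hy⟩ := ih (fun s hs => hx s (hs.trans (Nat.lt_succ_self t))) hl
    refine ⟨fun r => if r ≤ t then y r else k, by simpa using hy0, by simp, fun r hr => ?_⟩
    have hrt : r ≤ t := Nat.lt_succ_iff.1 hr
    rcases hrt.lt_or_eq with hlt | rfl
    · have : r + 1 ≤ t := hlt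
      simpa [hrt, this] using hy r hlt
    · simpa [hyt] using hlk

theorem InClass.isConnectedGraph (hM : M.InClass) : IsConnectedGraph M.graph := by
  refine ⟨fun i h => h.1 rfl, fun i j hij => ?_⟩
  have h : M.timeComplexity i j < ⊤ := by
    refine lt_of_le_of_lt ?_ hM.connected
    exact le_iSup_of_le i (le_iSup_of_le j (le_iSup_of_le hij le_rfl))
  rw [timeComplexity, conversionTime, iInf_lt_iff] at h
  obtain ⟨t, ht⟩ := h
  rw [iInf_lt_iff] at ht
  obtain ⟨⟨-, x, h0, h1, hx⟩, -⟩ := ht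
  obtain ⟨y, hy0, hyt, hy⟩ := hM.isFair.exists_isLazyWalk (k := j) h0 hx (by rw [h1]; simp)
  have := hy.reflTransGen
  rw [hy0, hyt] at this
  rcases Relation.reflTransGen_iff_eq_or_transGen.1 this with e | e
  · exact absurd e.symm hij
  · exact e

/-! ### Uniqueness of prices -/

/-- A pure index pays its whole value in one commodity. -/
theorem IsFair.mul_rate_of_isPureIndex (hM : M.IsFair) {b : M.State} {p : Fin m → ℝ}
    (hp : M.IsPrice b p) {i j : Fin m} {h : M.K i} (hh : M.IsPureIndex j h) :
    p j * (M.rate b h j : ℝ) = p i := by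
  rw [← ((hM.isPrice_iff b p).1 hp).2 i h, Finset.sum_eq_single j]
  · intro k _ hk
    simp [hM.rate_eq_zero_of_isPureIndex hh hk]
  · simp

theorem InClass.price_mul_eq_mul (hM : M.InClass) {b : M.State} {p q : Fin m → ℝ}
    (hp : M.IsPrice b p) (hq : M.IsPrice b q) (i j : Fin m) : q i * p j = q j * p i := by
  have hF := hM.isFair
  have hadj : ∀ i j, M.graph.Adj i j → q i / p i = q j / p j := by
    rintro i j ⟨-, hij⟩
    obtain ⟨h, hh⟩ := hM.flexibility i j hij
    have h1 := hF.mul_rate_of_isPureIndex hp hh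
    have h2 := hF.mul_rate_of_isPureIndex hq hh
    have h3 : (M.rate b h j : ℝ) ≠ 0 := by
      intro e
      rw [e, mul_zero] at h1
      exact (hp.1 i).ne h1
    rw [← h1, ← h2, mul_div_mul_right _ _ h3]
  have hall : q i / p i = q j / p j := by
    by_cases hij : i = j
    · rw [hij]
    · have h := hM.isConnectedGraph.2 i j hij
      induction h with
      | single h => exact hadj _ _ h
      | tail _ h ih =>
        rename_i k l _
        by_cases hik : i = k
        · rw [hik]; exact hadj _ _ h
        · exact (ih hik).trans (hadj _ _ h)
  rwa [div_eq_div_iff (hp.1 i).ne' (hp.1 j).ne'] at hall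

theorem InClass.isPrice_price (hM : M.InClass) (b : M.State) : M.IsPrice b (M.price b) :=
  Classical.epsilon_spec (hM.exists_isPrice b)

theorem InClass.priceRatio_eq (hM : M.InClass) {b : M.State} {p : Fin m → ℝ}
    (hp : M.IsPrice b p) (i j : Fin m) : M.priceRatio i j b = p i / p j := by
  have h := hM.price_mul_eq_mul hp (hM.isPrice_price b) i j
  rw [priceRatio, div_eq_div_iff ((hM.isPrice_price b).1 j).ne' (hp.1 j).ne', h, mul_comm]

theorem InClass.exists_isPrice_mem_stdSimplex [Nonempty (Fin m)] (hM : M.InClass) (b : M.State) :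
    ∃ p, M.IsPrice b p ∧ p ∈ stdSimplex ℝ (Fin m) := by
  obtain ⟨p, hp⟩ := hM.exists_isPrice b
  have hs : 0 < ∑ i, p i := Finset.sum_pos (fun i _ => hp.1 i) Finset.univ_nonempty
  refine ⟨fun i => p i / ∑ k, p k, ⟨fun i => div_pos (hp.1 i) hs, fun a => ?_⟩,
    fun i => (div_pos (hp.1 i) hs).le, ?_⟩
  · simp only [div_mul_eq_mul_div, ← Finset.sum_div, hp.2 a, zero_div]
  · rw [← Finset.sum_div, div_self hs.ne']

variable (M) in
/-- The quantity of `i` whose value, at the prices `p`, is paid out in `j` when the aggregate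
offer is `b`. -/
def flow (b : M.State) (p : Fin m → ℝ) (i j : Fin m) : ℝ :=
  ∑ h : M.K i, (b.1 i h : ℝ) * (p j * (M.rate b h j : ℝ) / p i)

/-- Conservation says that the prices of a mechanism clear its flows. -/
theorem IsFair.isClearing_flow (hM : M.IsFair) {b : M.State} {p : Fin m → ℝ}
    (hp : M.IsPrice b p) : IsClearing (M.flow b p) p := by
  intro j
  have hp' := (hM.isPrice_iff b p).1 hp
  have h := congrArg (fun x : ℝ≥0 => (x : ℝ)) (hM.sum_mul_rate b j)
  push_cast at h
  rw [← Finset.mul_sum]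
  have h1 : ∑ i, M.flow b p j i = ∑ h, (b.1 j h : ℝ) := by
    simp only [flow]
    rw [Finset.sum_comm]
    refine Finset.sum_congr rfl fun x _ => ?_
    rw [← Finset.mul_sum, ← Finset.sum_div, hp'.2, div_self (hp'.1 j).ne', mul_one]
  rw [h1, ← h, Finset.mul_sum]
  refine Finset.sum_congr rfl fun i _ => ?_
  simp only [flow, Finset.mul_sum]
  refine Finset.sum_congr rfl fun x _ => ?_
  have := (hp'.1 i).ne'
  field_simp

end PreMechanism

/-! ### Graphical mechanisms -/

section Graphical

variable {m : ℕ} {G : Digraph (Fin m)}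

/-- An edge out of `i`, as an `i`-index. -/
def edge {i j : Fin m} (h : G.Adj i j) : (graphMechanism G).K i := (⟨j, h⟩ : {j // G.Adj i j})

/-- The commodity at the end of an edge. -/
def head {i : Fin m} (x : (graphMechanism G).K i) : Fin m := Subtype.val (p := G.Adj i) x

theorem adj_head {i : Fin m} (x : (graphMechanism G).K i) : G.Adj i (head x) :=
  Subtype.property (p := G.Adj i) x

theorem head_edge {i j : Fin m} (h : G.Adj i j) : head (edge h) = j := rfl

theorem edge_head {i : Fin m} (x : (graphMechanism G).K i) : edge (adj_head x) = x := rfl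

/-- `edgeMatrix`, with the offer in the type of offers of the graphical mechanism. -/
def offerMatrix (a : (graphMechanism G).Offer) (i j : Fin m) : ℝ≥0 := edgeMatrix G a i j

/-- `graphPrice`, with the offer in the type of offers of the graphical mechanism. -/
def offerPrice (b : (graphMechanism G).Offer) : Fin m → ℝ≥0 := graphPrice G b

theorem graphMechanism_rho {n : ℕ} (a : Fin n → (graphMechanism G).Offer)
    (ha : (graphMechanism G).PosAgg a) (s : Fin n) (i : Fin m) :
    (graphMechanism G).ρ n a ha s i =
      (offerPrice (∑ t, a t) i)⁻¹ * ∑ j, offerPrice (∑ t, a t) j * offerMatrix (a s) j i :=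
  rfl

theorem offerMatrix_of_adj (a : (graphMechanism G).Offer) {i j : Fin m}
    (h : G.Adj i j) : offerMatrix a i j = a i (edge h) := by
  exact dif_pos h

theorem offerMatrix_of_not_adj (a : (graphMechanism G).Offer) {i j : Fin m}
    (h : ¬ G.Adj i j) : offerMatrix a i j = 0 := by
  exact dif_neg h

theorem offerMatrix_add (a a' : (graphMechanism G).Offer) (i j : Fin m) :
    offerMatrix (a + a') i j = offerMatrix a i j + offerMatrix a' i j := by
  by_cases h : G.Adj i j
  · simp only [offerMatrix_of_adj _ h]; rfl
  · simp [offerMatrix_of_not_adj _ h]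

/-- A sum over the edges out of `i` as a sum over all commodities. -/
theorem sum_head_eq_sum {α : Type*} [AddCommMonoid α] {i : Fin m}
    (f : (graphMechanism G).K i → α) (g : Fin m → α) (hf : ∀ x, f x = g (head x))
    (hg : ∀ j, ¬ G.Adj i j → g j = 0) : ∑ x, f x = ∑ j, g j := by
  classical
  rw [← Finset.sum_subset (Finset.subset_univ (Finset.univ.filter (G.Adj i)))
    (fun j _ hj => hg j (by simpa using hj)),
    Finset.sum_subtype (F := (graphMechanism G).fintypeK i) _ (p := G.Adj i) (by simp)]
  exact Finset.sum_congr rfl fun x _ => hf x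

theorem sum_offerMatrix_mul (a : (graphMechanism G).Offer) (f : Fin m → ℝ≥0) (i : Fin m) :
    ∑ x, a i x * f (head x) = ∑ j, offerMatrix a i j * f j :=
  sum_head_eq_sum _ _ (fun x => by rw [offerMatrix_of_adj a (adj_head x), edge_head])
    fun j hj => by rw [offerMatrix_of_not_adj a hj, zero_mul]

theorem sum_offerMatrix (a : (graphMechanism G).Offer) (i : Fin m) :
    ∑ j, offerMatrix a i j = (graphMechanism G).total a i := by
  simpa [PreMechanism.total] using (sum_offerMatrix_mul a (fun _ => 1) i).symm

theorem transGen_offerMatrix (hG : IsConnectedGraph G) (b : (graphMechanism G).State)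
    (i j : Fin m) (hij : i ≠ j) :
    Relation.TransGen (fun i j => 0 < (offerMatrix b.1 i j : ℝ)) i j := by
  refine Relation.TransGen.mono (fun k l h => ?_) i j (hG.2 i j hij)
  rw [offerMatrix_of_adj b.1 h]
  exact_mod_cast b.2 k (edge h)

theorem isGraphPrice_iff (b : (graphMechanism G).Offer) (p : Fin m → ℝ≥0) :
    IsGraphPrice G b p ↔ (∀ i, 0 < p i) ∧
      IsClearing (fun i j => (offerMatrix b i j : ℝ)) (fun i => (p i : ℝ)) := by
  refine and_congr_right fun _ => forall_congr' fun j => ?_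
  rw [← NNReal.coe_inj]
  push_cast
  rfl

theorem isGraphPrice_offerPrice (hG : IsConnectedGraph G) (b : (graphMechanism G).State) :
    IsGraphPrice G b.1 (offerPrice b.1) := by
  obtain ⟨p, hp0, hp⟩ := exists_isClearing_pos (fun i j => (offerMatrix b.1 i j).coe_nonneg)
    (transGen_offerMatrix hG b)
  exact Classical.epsilon_spec (p := IsGraphPrice G b.1) ⟨fun i => NNReal.mk (p i) (hp0 i).le,
    (isGraphPrice_iff b.1 _).2 ⟨fun i => hp0 i, hp⟩⟩

theorem offerPrice_pos (hG : IsConnectedGraph G) (b : (graphMechanism G).State) (i : Fin m) :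
    0 < offerPrice b.1 i :=
  (isGraphPrice_offerPrice hG b).1 i

theorem offerPrice_clearing (hG : IsConnectedGraph G) (b : (graphMechanism G).State) (j : Fin m) :
    ∑ i, offerPrice b.1 i * offerMatrix b.1 i j = ∑ i, offerPrice b.1 j * offerMatrix b.1 j i :=
  (isGraphPrice_offerPrice hG b).2 j

/-- Any clearing vector of an aggregate offer is proportional to its graph price. -/
theorem mul_offerPrice_eq_mul (hG : IsConnectedGraph G) (b : (graphMechanism G).State)
    {q : Fin m → ℝ} (hq : IsClearing (fun i j => (offerMatrix b.1 i j : ℝ)) q) (i j : Fin m) :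
    q i * offerPrice b.1 j = q j * offerPrice b.1 i := by
  obtain ⟨hp0, hp⟩ := (isGraphPrice_iff b.1 _).1 (isGraphPrice_offerPrice hG b)
  exact hp.mul_eq_mul hq (fun i j => (offerMatrix b.1 i j).coe_nonneg)
    (transGen_offerMatrix hG b) (fun i => by exact_mod_cast hp0 i) i j

theorem mergeLast_map {X Y : Type} [Add X] [Add Y] (f : X → Y)
    (hf : ∀ x x', f (x + x') = f x + f x') {n : ℕ} (x : Fin (n + 2) → X) (s : Fin (n + 1)) :
    f (mergeLast x s) = mergeLast (fun s => f (x s)) s := by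
  induction s using Fin.lastCases with
  | last => simp [mergeLast, hf]
  | cast s => simp [mergeLast]

theorem graphMechanism_value (hG : IsConnectedGraph G) {n : ℕ}
    (a : Fin n → (graphMechanism G).Offer) (ha : (graphMechanism G).PosAgg a) (s : Fin n) :
    ∑ i, offerPrice (∑ t, a t) i * (graphMechanism G).ρ n a ha s i =
      ∑ i, offerPrice (∑ t, a t) i * (graphMechanism G).total (a s) i := by
  have hp : ∀ i, 0 < offerPrice (∑ t, a t) i := offerPrice_pos hG (PreMechanism.sumState a ha)
  simp only [graphMechanism_rho, mul_inv_cancel_left₀ (hp _).ne']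
  rw [Finset.sum_comm]
  refine Finset.sum_congr rfl fun i _ => ?_
  rw [← Finset.mul_sum, sum_offerMatrix]

theorem graphMechanism_isFair (hG : IsConnectedGraph G) : (graphMechanism G).IsFair where
  exchange := by
    intro n a ha
    have hp : ∀ i, 0 < offerPrice (∑ t, a t) i := offerPrice_pos hG (PreMechanism.sumState a ha)
    have hcl := offerPrice_clearing hG (PreMechanism.sumState a ha)
    simp only [PreMechanism.sumState] at hcl
    have hsum : ∀ i j, ∑ s, offerMatrix (a s) i j = offerMatrix (∑ s, a s) i j := by
      intro i j
      by_cases h : G.Adj i j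
      · simp only [offerMatrix_of_adj _ h, Finset.sum_apply]
      · simp [offerMatrix_of_not_adj _ h]
    funext i
    rw [Finset.sum_apply, Finset.sum_apply]
    simp only [graphMechanism_rho]
    rw [← Finset.mul_sum, Finset.sum_comm]
    simp only [← Finset.mul_sum, hsum]
    rw [hcl i, ← Finset.mul_sum, inv_mul_cancel_left₀ (hp i).ne']
    simp only [← hsum]
    rw [Finset.sum_comm]
    exact Finset.sum_congr rfl fun s _ => sum_offerMatrix (a s) i
  anonymity := by
    intro n a ha σ ha'
    have h : ∑ t, a (σ t) = ∑ t, a t := Equiv.sum_comp σ a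
    funext s i
    simp only [graphMechanism_rho, h]
  aggregation := by
    intro n a ha ha'
    funext s i
    have h := mergeLast_map (fun (x : (graphMechanism G).Offer) (i : Fin m) =>
      (offerPrice (∑ t, a t) i)⁻¹ *
        ∑ j, offerPrice (∑ t, a t) j * offerMatrix x j i) (fun x x' => by
          funext i
          simp only [offerMatrix_add, mul_add, Finset.sum_add_distrib, Pi.add_apply]) a s
    rw [graphMechanism_rho, PreMechanism.sum_mergeLast]
    exact congrFun h i
  invariance := by
    intro n a ha lam hlam ha'
    set b := PreMechanism.sumState a ha with hb
    set b' := PreMechanism.sumState _ ha' with hb'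
    have hresc : ∀ (x : (graphMechanism G).Offer) i j,
        offerMatrix ((graphMechanism G).rescale lam x) i j = lam i * offerMatrix x i j := by
      intro x i j
      by_cases h : G.Adj i j
      · simp only [offerMatrix_of_adj _ h]; rfl
      · simp [offerMatrix_of_not_adj _ h]
    have hbb : b'.1 = (graphMechanism G).rescale lam b.1 := by
      funext i h
      simp [hb, hb', PreMechanism.sumState, PreMechanism.rescale, Finset.sum_apply,
        Finset.mul_sum]
    have hp := offerPrice_pos hG b
    have hp' := offerPrice_pos hG b'
    -- prices in the new units, multiplied by the factors of the change of units, clear the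
    -- original offers
    have hcl : IsClearing (fun i j => (offerMatrix b.1 i j : ℝ))
        (fun i => (lam i * offerPrice b'.1 i : ℝ)) := by
      intro j
      have hoff : ∀ i j, offerMatrix b'.1 i j = lam i * offerMatrix b.1 i j := by
        intro i j; rw [hbb, hresc]
      have h := congrArg (fun x : ℝ≥0 => (x : ℝ)) (offerPrice_clearing hG b' j)
      simp only [hoff] at h
      push_cast at h
      calc _ = _ := Finset.sum_congr rfl fun i _ => by ring
        _ = _ := h
        _ = _ := Finset.sum_congr rfl fun i _ => by ring
    have hprop : ∀ i j, lam i * offerPrice b'.1 i * offerPrice b.1 j =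
        lam j * offerPrice b'.1 j * offerPrice b.1 i := by
      intro i j
      exact_mod_cast mul_offerPrice_eq_mul hG b hcl i j
    funext s i
    change (offerPrice b'.1 i)⁻¹ * ∑ j, offerPrice b'.1 j *
      offerMatrix ((graphMechanism G).rescale lam (a s)) j i =
      lam i * ((offerPrice b.1 i)⁻¹ * ∑ j, offerPrice b.1 j * offerMatrix (a s) j i)
    simp only [hresc, Finset.mul_sum]
    refine Finset.sum_congr rfl fun j _ => ?_
    have h1 := (hp i).ne'
    have h2 := (hp' i).ne'
    have h3 := hprop j i
    field_simp
    calc _ = lam j * offerPrice b'.1 j * offerPrice b.1 i * offerMatrix (a s) j i := by ring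
      _ = _ := by rw [h3]; ring

theorem graphMechanism_ret (a : (graphMechanism G).Offer) (b : (graphMechanism G).State)
    (hab : a ≤ b.1) (k : Fin m) : (graphMechanism G).ret a b k =
      (offerPrice b.1 k)⁻¹ * ∑ j, offerPrice b.1 j * offerMatrix a j k := by
  have h : ∑ t, ![a, b.1 - a] t = b.1 := by
    rw [Fin.sum_univ_two]
    exact add_tsub_cancel_of_le hab
  rw [PreMechanism.ret, graphMechanism_rho, h]
  rfl

theorem offerMatrix_smul_unitOffer {i : Fin m} (h : (graphMechanism G).K i) (x : ℝ≥0)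
    (j k : Fin m) : offerMatrix (x • (graphMechanism G).unitOffer h) j k =
      if i = j ∧ head h = k then x else 0 := by
  classical
  by_cases hjk : G.Adj j k
  · rw [offerMatrix_of_adj _ hjk]
    by_cases hij : i = j
    · subst hij
      by_cases hk : head h = k
      · subst hk
        simp [PreMechanism.unitOffer, edge_head]
      · have : edge hjk ≠ h := fun e => hk (by rw [← e, head_edge])
        simp [PreMechanism.unitOffer, hk, Pi.single_eq_of_ne this]
    · simp [PreMechanism.unitOffer, hij]
  · rw [offerMatrix_of_not_adj _ hjk, if_neg]
    rintro ⟨rfl, rfl⟩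
    exact hjk (adj_head h)

theorem graphMechanism_rate (b : (graphMechanism G).State) {i : Fin m}
    (h : (graphMechanism G).K i) (k : Fin m) : (graphMechanism G).rate b h k =
      if head h = k then offerPrice b.1 i / offerPrice b.1 k else 0 := by
  have hb := (b.2 i h).ne'
  rw [PreMechanism.rate, graphMechanism_ret _ _ (PreMechanism.smul_unitOffer_le le_rfl h)]
  simp only [offerMatrix_smul_unitOffer]
  by_cases hk : head h = k
  · simp only [hk, and_true, mul_ite, mul_zero, Finset.sum_ite_eq, Finset.mem_univ, if_true]
    rw [← mul_assoc, mul_div_assoc, div_self hb, mul_one, div_eq_inv_mul]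
  · simp [hk]

theorem graphMechanism_isPureIndex (hG : IsConnectedGraph G) {i : Fin m}
    (h : (graphMechanism G).K i) : (graphMechanism G).IsPureIndex (head h) h := by
  have hF := graphMechanism_isFair hG
  let b : (graphMechanism G).State := ⟨fun _ _ => 1, fun _ _ => one_pos⟩
  refine ⟨(hF.isIndex_iff h _).2 ⟨b, ?_⟩, ?_⟩
  · rw [graphMechanism_rate, if_pos rfl]
    exact div_pos (offerPrice_pos hG b _) (offerPrice_pos hG b _)
  · intro a ha k hk
    by_contra hne
    obtain ⟨b, hb⟩ := (hF.isIndex_iff h k).1 ⟨a, ha, pos_iff_ne_zero.2 hne⟩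
    rw [graphMechanism_rate, if_neg (Ne.symm hk)] at hb
    exact lt_irrefl _ hb

/-- Value is conserved at positive prices, so no trader can only lose; the other conditions are
checked on the formula for the returns. -/
theorem graphMechanism_inClass (hG : IsConnectedGraph G)
    (hc : (graphMechanism G).IsConnected) : (graphMechanism G).InClass where
  exchange := (graphMechanism_isFair hG).exchange
  anonymity := (graphMechanism_isFair hG).anonymity
  aggregation := (graphMechanism_isFair hG).aggregation
  invariance := (graphMechanism_isFair hG).invariance
  nonDissipation := by
    intro n a ha s
    by_contra! hcon
    obtain ⟨hne, hle⟩ := hcon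
    have hp : ∀ i, 0 < offerPrice (∑ t, a t) i := offerPrice_pos hG (PreMechanism.sumState a ha)
    have hv := graphMechanism_value hG a ha s
    refine hne (funext fun i => ?_)
    have h := (Finset.sum_eq_sum_iff_of_le
      (fun i _ => mul_le_mul_right (hle i) _)).1 hv i (Finset.mem_univ i)
    exact mul_left_cancel₀ (hp i).ne' h
  flexibility := by
    rintro i j ⟨h, hh⟩
    obtain ⟨a, ha, hpos⟩ := hh
    refine ⟨h, ?_⟩
    have hpure := graphMechanism_isPureIndex hG h
    have : j = head h := by
      by_contra hne
      exact hpos.ne' (hpure.2 a ha j hne)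
    rwa [this]
  connected := hc

/-- Some aggregate offer has equal prices: offer on every edge out of `i` the price of `i` at the
aggregate offer that is `1` on every edge. -/
theorem exists_state_offerPrice_eq (hG : IsConnectedGraph G) :
    ∃ b : (graphMechanism G).State, ∀ i j, offerPrice b.1 i = offerPrice b.1 j := by
  let c : (graphMechanism G).State := ⟨fun _ _ => 1, fun _ _ => one_pos⟩
  let b : (graphMechanism G).State :=
    ⟨fun i _ => offerPrice c.1 i, fun i _ => offerPrice_pos hG c i⟩
  have e : ∀ i j, offerMatrix b.1 i j = offerPrice c.1 i * offerMatrix c.1 i j := by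
    intro i j
    by_cases h : G.Adj i j
    · simp [offerMatrix_of_adj _ h, b, c]
    · simp [offerMatrix_of_not_adj _ h]
  refine ⟨b, fun i j => ?_⟩
  have hcl : IsClearing (fun i j => (offerMatrix b.1 i j : ℝ)) (fun _ => 1) := by
    intro j
    simp only [e, one_mul]
    exact_mod_cast offerPrice_clearing hG c j
  have := mul_offerPrice_eq_mul hG b hcl i j
  rw [one_mul, one_mul, NNReal.coe_inj] at this
  exact this.symm

theorem graphMechanism_converts_self (hG : IsConnectedGraph G) (i : Fin m) :
    (graphMechanism G).Converts (Pi.single i 1) (Pi.single i 1) := by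
  refine ⟨0, ⟨fun _ _ => 1, fun _ _ => one_pos⟩, ?_, fun j => ?_⟩
  · intro j; simp [PreMechanism.total]
  · rw [(graphMechanism_isFair hG).netTrade_eq]
    simp [PreMechanism.total]

/-- At equal prices an edge exchanges one unit for one unit. -/
theorem graphMechanism_converts_of_adj (hG : IsConnectedGraph G) {i j : Fin m} (h : G.Adj i j) :
    (graphMechanism G).Converts (Pi.single i 1) (Pi.single j 1) := by
  obtain ⟨b, hb⟩ := exists_state_offerPrice_eq hG
  have hF := graphMechanism_isFair hG
  have hunit : ∀ l k, offerMatrix ((graphMechanism G).unitOffer (edge h)) l k =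
      if i = l ∧ j = k then 1 else 0 := fun l k => by
    rw [← one_smul ℝ≥0 ((graphMechanism G).unitOffer (edge h)), offerMatrix_smul_unitOffer,
      head_edge]
  have htot : (graphMechanism G).total ((graphMechanism G).unitOffer (edge h)) =
      Pi.single i 1 := by
    funext k
    rw [← sum_offerMatrix]
    simp only [hunit]
    by_cases hk : i = k
    · subst hk; simp
    · simp [hk]
  refine ⟨(graphMechanism G).unitOffer (edge h), b, htot.le, fun k => ?_⟩
  have hret : ∑ l, ∑ y, (graphMechanism G).unitOffer (edge h) l y *
      (graphMechanism G).rate b y k = (Pi.single j 1 : Fin m → ℝ≥0) k := by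
    have hp := (offerPrice_pos hG b k).ne'
    simp only [graphMechanism_rate, hb _ k, div_self hp]
    simp only [sum_offerMatrix_mul _ (fun l => if l = k then (1 : ℝ≥0) else 0), hunit]
    by_cases hk : j = k
    · subst hk; simp
    · simp [hk]
  rw [hF.netTrade_eq, hret, htot]
  ring

end Graphical

/-! ### Comparison of a mechanism with the mechanism of its graph -/

section Comparison

variable {m : ℕ} {M : PreMechanism m} {G : Digraph (Fin m)}

theorem timeComplexity_graph_le (hM : M.InClass) (i j : Fin m) :
    (graphMechanism M.graph).timeComplexity i j ≤ M.timeComplexity i j := by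
  refine le_iInf₂ fun t ht => ?_
  obtain ⟨ht1, x, h0, h1, hx⟩ := ht
  obtain ⟨y, hy0, hyt, hy⟩ := hM.isFair.exists_isLazyWalk (k := j) h0 hx (by rw [h1]; simp)
  refine iInf₂_le t ⟨ht1, fun s => Pi.single (y s) 1, by simp only [hy0], by simp only [hyt],
    fun s hs => ?_⟩
  rcases hy s hs with e | e
  · simp only [← e]
    exact graphMechanism_converts_self hM.isConnectedGraph _
  · exact graphMechanism_converts_of_adj hM.isConnectedGraph e

theorem graphMechanism_graph_inClass (hM : M.InClass) : (graphMechanism M.graph).InClass :=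
  graphMechanism_inClass hM.isConnectedGraph <| lt_of_le_of_lt
    (iSup_mono fun i => iSup_mono fun j => iSup_mono fun _ => timeComplexity_graph_le hM i j)
    hM.connected

/-- A choice of a pure `ij`-index of `M` for every edge `ij` of `G`. -/
def IsPureChoice (M : PreMechanism m) (c : ∀ i, (graphMechanism G).K i → M.K i) : Prop :=
  ∀ i x, M.IsPureIndex (head x) (c i x)

theorem exists_isPureChoice (hM : M.InClass) :
    ∃ c : ∀ i, (graphMechanism M.graph).K i → M.K i, IsPureChoice M c := by
  have h : ∀ i (x : (graphMechanism M.graph).K i), ∃ h : M.K i, M.IsPureIndex (head x) h :=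
    fun i x => hM.flexibility i _ (adj_head x).2
  choose c hc using h
  exact ⟨c, hc⟩

theorem isPureChoice_id (hG : IsConnectedGraph G) :
    IsPureChoice (graphMechanism G) (fun _ x => x) :=
  fun _ x => graphMechanism_isPureIndex hG x

theorem IsPureChoice.injective {c : ∀ i, (graphMechanism G).K i → M.K i}
    (hc : IsPureChoice M c) (i : Fin m) : Function.Injective (c i) := by
  intro x y hxy
  have hhead : head x = head y := by
    by_contra hne
    obtain ⟨a, ha, hpos⟩ := (hc i x).1
    have h := (hc i y).2
    rw [← hxy] at h
    exact hpos.ne' (h a ha _ hne)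
  exact Subtype.ext (p := G.Adj i) hhead

/-- The part of an aggregate offer that lies on the chosen pure indices. -/
def pullState (c : ∀ i, (graphMechanism G).K i → M.K i) (b : M.State) :
    (graphMechanism G).State :=
  ⟨fun i x => b.1 i (c i x), fun i x => b.2 i (c i x)⟩

open Classical in
/-- The flow of a mechanism is the matrix of the offers on the chosen pure indices, plus
the contribution of all other indices. -/
theorem IsPureChoice.flow_eq (hM : M.IsFair) {c : ∀ i, (graphMechanism G).K i → M.K i}
    (hc : IsPureChoice M c) {b : M.State} {p : Fin m → ℝ} (hp : M.IsPrice b p) (i j : Fin m) :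
    M.flow b p i j = offerMatrix (pullState c b).1 i j +
      ∑ h ∈ (Finset.univ.image (c i))ᶜ, (b.1 i h : ℝ) * (p j * (M.rate b h j : ℝ) / p i) := by
  rw [PreMechanism.flow, ← Finset.sum_add_sum_compl (Finset.univ.image (c i)),
    Finset.sum_image fun x _ y _ h => hc.injective i h]
  congr 1
  have hpi := (hp.1 i).ne'
  have hq : ∀ x, p j * (M.rate b (c i x) j : ℝ) / p i =
      ((if head x = j then 1 else 0 : ℝ≥0) : ℝ) := by
    intro x
    by_cases hx : head x = j
    · subst hx
      rw [hM.mul_rate_of_isPureIndex hp (hc i x), div_self hpi, if_pos rfl, NNReal.coe_one]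
    · rw [hM.rate_eq_zero_of_isPureIndex (hc i x) (Ne.symm hx), if_neg hx]
      simp
  simp only [hq]
  have h := sum_offerMatrix_mul (pullState c b).1 (fun l => if l = j then (1 : ℝ≥0) else 0) i
  simp only [mul_ite, mul_one, mul_zero, Finset.sum_ite_eq', Finset.mem_univ, if_true] at h
  rw [← h]
  push_cast
  refine Finset.sum_congr rfl fun x _ => ?_
  split_ifs <;> simp [pullState]

theorem IsPureChoice.isClearing_of_surjective (hM : M.IsFair)
    {c : ∀ i, (graphMechanism G).K i → M.K i} (hc : IsPureChoice M c)
    (hs : ∀ i, Function.Surjective (c i)) {b : M.State} {p : Fin m → ℝ} (hp : M.IsPrice b p) :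
    IsClearing (fun i j => (offerMatrix (pullState c b).1 i j : ℝ)) p := by
  classical
  have hflow : M.flow b p = fun i j => (offerMatrix (pullState c b).1 i j : ℝ) := by
    funext i j
    rw [hc.flow_eq hM hp, Finset.image_univ_of_surjective (hs i)]
    simp
  rw [← hflow]
  exact hM.isClearing_flow hp

/-- The extension of an aggregate offer of the graphical mechanism by `ε` on all indices that are
not chosen. -/
def extendState (c : ∀ i, (graphMechanism G).K i → M.K i) (b : (graphMechanism G).State)
    (ε : ℝ≥0) (hε : 0 < ε) : M.State :=
  ⟨fun i h => Function.extend (c i) (b.1 i) (fun _ => ε) h, fun i h => by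
    classical
    simp only [Function.extend_def]
    split_ifs
    · exact b.2 _ _
    · exact hε⟩

theorem extendState_apply {c : ∀ i, (graphMechanism G).K i → M.K i} (hc : IsPureChoice M c)
    (b : (graphMechanism G).State) {ε : ℝ≥0} (hε : 0 < ε) (i : Fin m) (x) :
    (extendState c b ε hε).1 i (c i x) = b.1 i x :=
  (hc.injective i).extend_apply (b.1 i) (fun _ => ε) x

theorem extendState_apply_of_notMem (c : ∀ i, (graphMechanism G).K i → M.K i)
    (b : (graphMechanism G).State) {ε : ℝ≥0} (hε : 0 < ε) {i : Fin m} {h : M.K i}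
    (hh : ¬ ∃ x, c i x = h) : (extendState c b ε hε).1 i h = ε :=
  Function.extend_apply' (b.1 i) (fun _ => ε) h hh

/-- As the offers on the other indices vanish, the flows tend to the offers on the chosen ones:
the share of the value of an offer that is paid in a given commodity is at most one. -/
theorem IsPureChoice.tendsto_flow (hM : M.IsFair) {c : ∀ i, (graphMechanism G).K i → M.K i}
    (hc : IsPureChoice M c) (b : (graphMechanism G).State) {ε : ℕ → ℝ≥0} (hε : ∀ n, 0 < ε n)
    (hε0 : Filter.Tendsto ε Filter.atTop (nhds 0)) {p : ℕ → Fin m → ℝ}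
    (hp : ∀ n, M.IsPrice (extendState c b (ε n) (hε n)) (p n)) (i j : Fin m) :
    Filter.Tendsto (fun n => M.flow (extendState c b (ε n) (hε n)) (p n) i j) Filter.atTop
      (nhds (offerMatrix b.1 i j : ℝ)) := by
  classical
  have hpull : ∀ n, pullState c (extendState c b (ε n) (hε n)) = b := fun n =>
    Subtype.ext (funext fun i => funext fun x => extendState_apply hc b (hε n) i x)
  have hshare : ∀ n (h : M.K i), 0 ≤ p n j *
      (M.rate (extendState c b (ε n) (hε n)) h j : ℝ) / p n i ∧
      p n j * (M.rate (extendState c b (ε n) (hε n)) h j : ℝ) / p n i ≤ 1 := by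
    intro n h
    have hp' := (hM.isPrice_iff _ _).1 (hp n)
    have hnn : ∀ k, 0 ≤ p n k * (M.rate (extendState c b (ε n) (hε n)) h k : ℝ) := fun k =>
      mul_nonneg (hp'.1 k).le (NNReal.coe_nonneg _)
    refine ⟨div_nonneg (hnn j) (hp'.1 i).le, (div_le_one (hp'.1 i)).2 ?_⟩
    rw [← hp'.2 i h]
    exact Finset.single_le_sum (f := fun k => p n k *
      (M.rate (extendState c b (ε n) (hε n)) h k : ℝ)) (fun k _ => hnn k) (Finset.mem_univ j)
  have hval : ∀ n, ∀ h ∈ (Finset.univ.image (c i))ᶜ,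
      ((extendState c b (ε n) (hε n)).1 i h : ℝ) = ε n := by
    intro n h hh
    rw [extendState_apply_of_notMem c b (hε n) (by simpa using hh)]
  have hεr : Filter.Tendsto (fun n => (ε n : ℝ)) Filter.atTop (nhds 0) :=
    NNReal.tendsto_coe.2 hε0
  have hlim : Filter.Tendsto (fun n => ∑ h ∈ (Finset.univ.image (c i))ᶜ,
      ((extendState c b (ε n) (hε n)).1 i h : ℝ) *
        (p n j * (M.rate (extendState c b (ε n) (hε n)) h j : ℝ) / p n i))
      Filter.atTop (nhds 0) := by
    have key : ∀ h ∈ (Finset.univ.image (c i))ᶜ, Filter.Tendsto (fun n =>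
        ((extendState c b (ε n) (hε n)).1 i h : ℝ) *
          (p n j * (M.rate (extendState c b (ε n) (hε n)) h j : ℝ) / p n i))
        Filter.atTop (nhds 0) := by
      intro h hh
      refine squeeze_zero (fun n => mul_nonneg (NNReal.coe_nonneg _) (hshare n h).1)
        (fun n => ?_) hεr
      rw [hval n h hh]
      exact mul_le_of_le_one_right (NNReal.coe_nonneg _) (hshare n h).2
    have := tendsto_finsetSum _ key
    rwa [Finset.sum_const_zero] at this
  have := (tendsto_const_nhds (x := (offerMatrix b.1 i j : ℝ))).add hlim
  rw [add_zero] at this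
  refine this.congr fun n => ?_
  rw [hc.flow_eq hM (hp n), hpull]

/-- If the ratio of two prices in the graphical mechanism depends on an edge, then the ratio in `M`
depends on the pure index chosen for this edge: `M` approximates the graphical prices when little
is offered on the other indices. -/
theorem IsPureChoice.isInfluential (hM : M.InClass)
    {c : ∀ i, (graphMechanism M.graph).K i → M.K i} (hc : IsPureChoice M c) {i j k : Fin m}
    {x : (graphMechanism M.graph).K k}
    (hx : PreMechanism.IsInfluential _ ((graphMechanism M.graph).priceRatio i j) ⟨k, x⟩) :
    M.IsInfluential (M.priceRatio i j) ⟨k, c k x⟩ := by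
  have hne : Nonempty (Fin m) := ⟨i⟩
  have hG := hM.isConnectedGraph
  have hMG := graphMechanism_graph_inClass hM
  obtain ⟨b, b', hbb, hr⟩ := hx
  by_contra hcon
  let ε : ℕ → ℝ≥0 := fun n => 1 / ((n : ℝ≥0) + 1)
  have hε : ∀ n, 0 < ε n := fun n => by positivity
  have hε0 : Filter.Tendsto ε Filter.atTop (nhds 0) := tendsto_one_div_add_atTop_nhds_zero_nat
  have hlim : ∀ b : (graphMechanism M.graph).State, Filter.Tendsto
      (fun n => M.priceRatio i j (extendState c b (ε n) (hε n))) Filter.atTop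
      (nhds ((graphMechanism M.graph).priceRatio i j b)) := by
    intro b
    obtain ⟨q, hq, hq1⟩ := hMG.exists_isPrice_mem_stdSimplex b
    choose p hp hp1 using fun n =>
      hM.exists_isPrice_mem_stdSimplex (extendState c b (ε n) (hε n))
    have hqc : IsClearing (fun i j => (offerMatrix b.1 i j : ℝ)) q :=
      (isPureChoice_id hG).isClearing_of_surjective hMG.isFair
        (fun _ => Function.surjective_id) hq
    have ht := tendsto_pi_nhds.1 <| tendsto_of_isClearing
      (fun i j => (offerMatrix b.1 i j).coe_nonneg) (transGen_offerMatrix hG b) hqc hq.1 hq1.2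
      (hc.tendsto_flow hM.isFair b hε hε0 hp)
      (fun n => hM.isFair.isClearing_flow (hp n)) hp1
    rw [hMG.priceRatio_eq hq]
    refine ((ht i).div (ht j) (hq.1 j).ne').congr fun n => ?_
    rw [Pi.div_apply, hM.priceRatio_eq (hp n)]
  refine hr (tendsto_nhds_unique (hlim b) ((hlim b').congr fun n => ?_))
  by_contra hne
  refine hcon ⟨extendState c b (ε n) (hε n), extendState c b' (ε n) (hε n), ?_, Ne.symm hne⟩
  rintro ⟨l, h⟩ hl
  by_cases hh : ∃ y, c l y = h
  · obtain ⟨y, rfl⟩ := hh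
    simp only [extendState_apply hc]
    refine hbb ⟨l, y⟩ fun e => hl ?_
    cases e
    rfl
  · simp only [extendState_apply_of_notMem c _ _ hh]

theorem IsPureChoice.noMoreComplex (hM : M.InClass)
    {c : ∀ i, (graphMechanism M.graph).K i → M.K i} (hc : IsPureChoice M c) :
    (graphMechanism M.graph).NoMoreComplex M := by
  refine ⟨timeComplexity_graph_le hM, fun i j => ?_,
    fun i => Fintype.card_le_of_injective _ (hc.injective i)⟩
  refine Nat.card_le_card_of_injective
    (fun y => ⟨⟨y.1.1, c y.1.1 y.1.2⟩, hc.isInfluential hM y.2⟩) ?_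
  rintro ⟨⟨k, x⟩, hx⟩ ⟨⟨l, y⟩, hy⟩ h
  simp only [Subtype.mk.injEq, Sigma.mk.injEq] at h
  obtain ⟨rfl, h⟩ := h
  cases hc.injective k (eq_of_heq h)
  rfl

theorem le_sumState {M : PreMechanism m} {n : ℕ} (a : Fin n → M.Offer) (ha : M.PosAgg a)
    (s : Fin n) : a s ≤ (PreMechanism.sumState a ha).1 :=
  Finset.single_le_sum (f := a) (fun _ _ => zero_le) (Finset.mem_univ s)

/-- If every index is a chosen pure index, conservation makes the prices of `M` clear the graph,
and the returns are those of the graphical mechanism. -/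
theorem IsPureChoice.isRelabelling (hM : M.InClass) (hG : IsConnectedGraph G)
    {e : ∀ i, M.K i ≃ (graphMechanism G).K i} (hc : IsPureChoice M fun i => (e i).symm) :
    PreMechanism.IsRelabelling M (graphMechanism G) e := by
  have hF := hM.isFair
  have hFG := graphMechanism_isFair hG
  intro n a ha ha'
  set b := PreMechanism.sumState a ha
  set b' := PreMechanism.sumState (fun s i h => a s i (e i h)) ha' with hb'
  have hpull : pullState (fun i => (e i).symm) b' = b := by
    refine Subtype.ext (funext fun i => funext fun x => ?_)
    simp [pullState, b, b', PreMechanism.sumState, Finset.sum_apply]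
  obtain ⟨p, hp⟩ := hM.exists_isPrice b'
  have hcl := hc.isClearing_of_surjective hF (fun i => (e i).symm.surjective) hp
  rw [hpull] at hcl
  have hrate : ∀ i (x : (graphMechanism G).K i) k,
      M.rate b' ((e i).symm x) k = (graphMechanism G).rate b x k := by
    intro i x k
    rw [graphMechanism_rate]
    by_cases hk : head x = k
    · subst hk
      rw [if_pos rfl, ← NNReal.coe_inj, NNReal.coe_div]
      have h1 := hF.mul_rate_of_isPureIndex hp (hc i x)
      have h2 := mul_offerPrice_eq_mul hG b hcl i (head x)
      have h3 : (0 : ℝ) < offerPrice b.1 (head x) := by exact_mod_cast offerPrice_pos hG b _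
      have h4 := hp.1 (head x)
      rw [eq_div_iff h3.ne']
      refine mul_left_cancel₀ h4.ne' ?_
      rw [← h2, ← h1]
      ring
    · rw [if_neg hk, hF.rate_eq_zero_of_isPureIndex (hc i x) (Ne.symm hk)]
  funext s k
  rw [hF.rho_eq_ret', hFG.rho_eq_ret', hF.ret_eq_sum_rate (le_sumState _ ha' s),
    hFG.ret_eq_sum_rate (le_sumState a ha s)]
  refine Finset.sum_congr rfl fun i _ => ?_
  rw [← Equiv.sum_comp (e i)]
  refine Finset.sum_congr rfl fun h _ => ?_
  rw [← hrate, Equiv.symm_apply_apply]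

/-- A minimal mechanism has no more indices than the mechanism of its graph, so the chosen pure
indices are all its indices. -/
theorem exists_isRelabelling_of_isMinimal (hM : M.IsMinimal) :
    ∃ G : Digraph (Fin m), IsConnectedGraph G ∧
      ∃ e : ∀ i, M.K i ≃ (graphMechanism G).K i,
        PreMechanism.IsRelabelling M (graphMechanism G) e ∧
        ∀ (i : Fin m) (h : M.K i), M.IsPureIndex (e i h).1 h := by
  obtain ⟨c, hc⟩ := exists_isPureChoice hM.1
  have hle := (hM.2 _ (graphMechanism_graph_inClass hM.1) (hc.noMoreComplex hM.1)).2.2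
  have hbij : ∀ i, Function.Bijective (c i) := fun i =>
    (Fintype.bijective_iff_injective_and_card (c i)).2 ⟨hc.injective i,
      le_antisymm (Fintype.card_le_of_injective _ (hc.injective i)) (hle i)⟩
  let e : ∀ i, M.K i ≃ (graphMechanism M.graph).K i := fun i =>
    (Equiv.ofBijective (c i) (hbij i)).symm
  refine ⟨M.graph, hM.1.isConnectedGraph, e, ?_, fun i h => ?_⟩
  · exact IsPureChoice.isRelabelling hM.1 hM.1.isConnectedGraph (e := e) hc
  · have h1 := hc i (e i h)
    have h2 : c i (e i h) = h := (Equiv.ofBijective (c i) (hbij i)).apply_symm_apply h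
    rw [h2] at h1
    exact h1

theorem minimalMechanisms_subset (m : ℕ) : minimalMechanisms m ⊆ graphicalMechanisms m := by
  rintro X ⟨M, hM, rfl⟩
  obtain ⟨G, hG, e, he, -⟩ := exists_isRelabelling_of_isMinimal hM
  exact ⟨G, hG, Quotient.sound ⟨e, he⟩⟩

theorem graphicalMechanisms_finite (m : ℕ) : (graphicalMechanisms m).Finite := by
  refine (Set.finite_range fun G : Digraph (Fin m) =>
    (Quotient.mk _ (graphMechanism G) : Mechanism m)).subset ?_
  rintro X ⟨G, -, rfl⟩
  exact ⟨G, rfl⟩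

end Comparison

end ExchangeMechanism

end

theorem mainTheorem2 (m : ℕ) :
    (∀ M : ExchangeMechanism.PreMechanism m, M.IsMinimal →
      ∃ G : Digraph (Fin m), ExchangeMechanism.IsConnectedGraph G ∧
        ∃ e : ∀ i, M.K i ≃ (ExchangeMechanism.graphMechanism G).K i,
          ExchangeMechanism.PreMechanism.IsRelabelling M (ExchangeMechanism.graphMechanism G) e ∧
          ∀ (i : Fin m) (h : M.K i), M.IsPureIndex (e i h).1 h) ∧
    ExchangeMechanism.minimalMechanisms m ⊆ ExchangeMechanism.graphicalMechanisms m ∧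
    (ExchangeMechanism.minimalMechanisms m).Finite := by
  exact ⟨fun _ hM => ExchangeMechanism.exists_isRelabelling_of_isMinimal hM,
    ExchangeMechanism.minimalMechanisms_subset m,
    (ExchangeMechanism.graphicalMechanisms_finite m).subset
      (ExchangeMechanism.minimalMechanisms_subset m)⟩
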